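/- **Setting.** Let $d,D,T,W,r\ge 1$ be integers with $1\le r<W$, and let $\sigma:\mathbb R\to\mathbb R$ be either bounded and Lipschitz, or the ReLU $\sigma(x)=\max\{x,0\}$. An MLP with $T$ hidden layers of width $W$ and parameters $\theta=(W^{(t)},b^{(t)})_{t=1}^{T+1}$ is the map $\hat f(\cdot|\theta):\mathbb R^d\to\mathbb R^D$, $$\hat f(x|\theta)=W^{(T+1)}x^{(T+1)}+b^{(T+1)},\qquad x^{(t+1)}=\sigma\bullet\big(W^{(t)}x^{(t)}+b^{(t)}\big)\ (1\le t\le T),\qquad x^{(1)}=x,$$ with $W^{(1)}\in\mathbb R^{W\times d}$, $W^{(t)}\in\mathbb R^{W\times W}$ for $2\le t\le T$, $W^{(T+1)}\in\mathbb R^{D\times W}$, and biases of matching size; $\sigma\bullet$ acts componentwise. Fix pre-trained parameters $\theta_{pre}=(W^{(t)},b^{(t)})_{t}$ and let $R_0=\|\theta_{pre}\|_\infty$ be the largest absolute value of their entries. Let $M,\nu>0$. On a probability space, let $B^{(1)},\dots,B^{(T)}\in\mathbb R^{W\times r}$ and $B^{(T+1)}\in\mathbb R^{D\times r}$ be random matrices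 whose entries are all i.i.d. $\mathcal N(0,\nu^2)$, and let $\mathcal F$ be the (random) class of all MLPs with weights $W^{(t)}+B^{(t)}A^{(t)}$ and biases $b^{(t)}$, where $A^{(t)}$ ($r$ rows, as many columns as $W^{(t)}$) ranges over all matrices with $|A^{(t)}_{ij}|\le M$ for all $t,i,j$. Let $\ell:\mathbb R^D\times\mathbb R^D\to[0,1]$ be $1$-Lipschitz for the Euclidean norm, let $\mathbb P$ be a probability measure on $\mathbb R^d\times\mathbb R^D$ that is carried by $[0,1]^d\times\mathbb R^D$, and let $(X_n,Y_n)_{n=1}^N$, $N\ge1$, be i.i.d. with law $\mathbb P$ and independent of $(B^{(t)})_t$. Put $$\mathcal R(f)=\mathbb E_{(X,Y)\sim\mathbb P}[\ell(f(X),Y)],\qquad \mathcal R^N(f)=\frac1N\sum_{n=1}^N\ell(f(X_n),Y_n),\qquad \mathbf G=\sup_{f\in\mathcal F}|\mathcal R(f)-\mathcal R^N(f)|.$$ For $0<\delta\le1$ put $\epsilon=1-\sqrt{1-\delta}$, $R=M\nu\sqrt{2r\log(2W/\epsilon)}$, and $q=r(W(T-1)+d+D)$. **Theorem (LoRA sample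 complexity: upper bound).** For every $\sigma$, $d$, $T$, $W$ as above and every $\kappa>1$ there is a constant $c>0$, depending only on these, such that the following holds for all $D$, $r$, $\theta_{pre}$, $M$, $\nu$, $\ell$, $\mathbb P$, $N$ as above and every $0<\delta\le1$ with $2R+2R_0\ge\kappa$: with probability at least $1-\delta$ (jointly over the random factors and the sample), $$\mathbf G\le 4\min\Big\{1,\ \sqrt q\,\frac{6\sqrt A}{\sqrt N}\Big\}+\sqrt{\frac{8\log\big(2/(1-\sqrt{1-\delta})\big)}{N}},\qquad A=(cT+1)\log(2R+2R_0).$$ -/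

import Mathlib

open MeasureTheory ProbabilityTheory
open scoped NNReal Matrix

namespace LoRA

noncomputable section

/-- The Euclidean space `ℝⁿ`. -/
abbrev E (n : ℕ) : Type := EuclideanSpace ℝ (Fin n)

/-- An activation function is admissible if it is bounded and Lipschitz, or if it is the ReLU. -/
def AdmissibleActivation (σ : ℝ → ℝ) : Prop :=
  ((∃ K : ℝ≥0, LipschitzWith K σ) ∧ ∃ C : ℝ, ∀ x, |σ x| ≤ C) ∨ σ = fun x => max x 0

/-- The input dimension of the layer with (zero-based) number `t`:
`d` for the first layer and `W` for all later ones. -/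
def inDim (d W : ℕ) : ℕ → ℕ
  | 0 => d
  | _ + 1 => W

/-- Weights and biases of an MLP `ℝ^d → ℝ^W → ⋯ → ℝ^W → ℝ^D` with `T` hidden layers of width `W`
(hence `T + 1` affine layers: `T` hidden ones and the output layer). -/
structure Params (d D T W : ℕ) where
  hiddenWeight : (t : Fin T) → Matrix (Fin W) (Fin (inDim d W t)) ℝ
  hiddenBias : Fin T → Fin W → ℝ
  outWeight : Matrix (Fin D) (Fin (inDim d W T)) ℝ
  outBias : Fin D → ℝ

/-- `‖θ‖_∞`: the largest absolute value of an entry of a weight matrix or of a bias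
(each norm below is the sup norm of a finite product of copies of `ℝ`). -/
def Params.supNorm {d D T W : ℕ} (θ : Params d D T W) : ℝ :=
  max
    (max ‖(fun t i j => θ.hiddenWeight t i j :
        (t : Fin T) → Fin W → Fin (inDim d W t) → ℝ)‖ ‖θ.hiddenBias‖)
    (max ‖(fun i j => θ.outWeight i j : Fin D → Fin (inDim d W T) → ℝ)‖ ‖θ.outBias‖)

/-- The input of the layer with (zero-based) number `t`: the input `x` of the network for `t = 0`,
and the componentwise activation of the affine image of the previous one afterwards. -/
def layerInput {d D T W : ℕ} (σ : ℝ → ℝ) (θ : Params d D T W) (x : Fin d → ℝ) :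
    (t : ℕ) → t ≤ T → Fin (inDim d W t) → ℝ
  | 0, _ => x
  | t + 1, h => fun i =>
      σ ((θ.hiddenWeight ⟨t, h⟩ *ᵥ layerInput σ θ x t (Nat.le_of_succ_le h)) i
        + θ.hiddenBias ⟨t, h⟩ i)

/-- The MLP with activation `σ` and parameters `θ`; its output layer is affine. -/
def mlp {d D T W : ℕ} (σ : ℝ → ℝ) (θ : Params d D T W) (x : E d) : E D :=
  WithLp.toLp 2 (θ.outWeight *ᵥ layerInput σ θ (fun i => x i) T le_rfl + θ.outBias)

/-- Positions of the entries of the frozen factors: one `W × r` matrix for each of the `T` hidden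
layers, and one `D × r` matrix for the output layer. -/
abbrev FrozenIdx (D T W r : ℕ) : Type := (Fin T × Fin W × Fin r) ⊕ (Fin D × Fin r)

/-- The frozen factor of the hidden layer `t`. -/
def hiddenFrozen {D T W r : ℕ} (b : FrozenIdx D T W r → ℝ) (t : Fin T) :
    Matrix (Fin W) (Fin r) ℝ :=
  Matrix.of fun i k => b (Sum.inl (t, i, k))

/-- The frozen factor of the output layer. -/
def outFrozen {D T W r : ℕ} (b : FrozenIdx D T W r → ℝ) : Matrix (Fin D) (Fin r) ℝ :=
  Matrix.of fun i k => b (Sum.inr (i, k))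

/-- The trainable factors: an `r × (input dimension)` matrix for each layer. -/
structure Trainable (d T W r : ℕ) where
  hidden : (t : Fin T) → Matrix (Fin r) (Fin (inDim d W t)) ℝ
  out : Matrix (Fin r) (Fin (inDim d W T)) ℝ

/-- All entries of the trainable factors are at most `M` in absolute value. -/
def Trainable.BoundedBy {d T W r : ℕ} (a : Trainable d T W r) (M : ℝ) : Prop :=
  (∀ t k j, |a.hidden t k j| ≤ M) ∧ ∀ k j, |a.out k j| ≤ M

/-- The parameters `θ` with every weight matrix perturbed by the product of the frozen and the
trainable factor of its layer; the biases are unchanged. -/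
def perturb {d D T W r : ℕ} (θ : Params d D T W) (b : FrozenIdx D T W r → ℝ)
    (a : Trainable d T W r) : Params d D T W where
  hiddenWeight t := θ.hiddenWeight t + hiddenFrozen b t * a.hidden t
  hiddenBias := θ.hiddenBias
  outWeight := θ.outWeight + outFrozen b * a.out
  outBias := θ.outBias

/-- The class of fine-tuned networks for frozen factors `b` and weight bound `M`. -/
def loraClass {d D T W r : ℕ} (σ : ℝ → ℝ) (θ : Params d D T W) (M : ℝ)
    (b : FrozenIdx D T W r → ℝ) : Set (E d → E D) :=
  {f | ∃ a : Trainable d T W r, a.BoundedBy M ∧ f = mlp σ (perturb θ b a)}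

/-- The true risk. -/
def trueRisk {d D : ℕ} (P : Measure (E d × E D)) (ℓ : E D → E D → ℝ) (f : E d → E D) : ℝ :=
  ∫ z, ℓ (f z.1) z.2 ∂P

/-- The empirical risk on the sample `z`. -/
def empRisk {d D N : ℕ} (z : Fin N → E d × E D) (ℓ : E D → E D → ℝ) (f : E d → E D) : ℝ :=
  (1 / (N : ℝ)) * ∑ n, ℓ (f (z n).1) (z n).2

/-- The uniform generalization gap over a class `F` of functions (for a loss with values in
`[0, 1]` and nonempty `F` this is the supremum of a nonempty set bounded by `1`). -/
def genGap {d D N : ℕ} (P : Measure (E d × E D)) (ℓ : E D → E D → ℝ)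
    (F : Set (E d → E D)) (z : Fin N → E d × E D) : ℝ :=
  ⨆ f : F, |trueRisk P ℓ f - empRisk z ℓ f|

/-- `1 - √(1 - δ)`. -/
def epsOf (δ : ℝ) : ℝ := 1 - √(1 - δ)

/-- `R = M ν √(2 r log (2 W / ε))`. -/
def radius (W r : ℕ) (M ν ε : ℝ) : ℝ := M * ν * √(2 * r * Real.log (2 * W / ε))

/-- `q = r (W (T - 1) + d + D)`. -/
def effDim (d D T W r : ℕ) : ℝ := r * (W * ((T : ℝ) - 1) + d + D)

/-- `4 min {1, √q · 6 √A / √N} + √(8 log (2 / ε) / N)` with `A = (c T + 1) log (2 R + 2 R₀)`. -/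
def gapBound (d D T W r N : ℕ) (c R R₀ ε : ℝ) : ℝ :=
  4 * min 1 (√(effDim d D T W r) * (6 * √((c * T + 1) * Real.log (2 * R + 2 * R₀)) / √(N : ℝ)))
    + √(8 * Real.log (2 / ε) / N)

end

end LoRA

/-! Condition on the frozen factors. Outside an event of probability `ε/2` all their entries are at
most `β = ν √(2 log (4 r (T W + D) / ε))`. On its complement, with the trainable entries rescaled to
the cube `[-1, 1]^p`, the loss is Lipschitz in them, with a constant `L` polynomial in `D` and `K =
2R + 2R₀` (`dist_mlp_le`, `perturbation_le_radius`). Chaining along dyadic grids of the cube, with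
Hoeffding's inequality for each link (`measure_exists_deviation_gt_le`), bounds all deviations at
once by `10 √(p log (3m) / N) + √(8u / N)`, where `m = ⌈2L⌉` and `u = log (2 / ε)`, outside a second
event of probability `ε/2`. The ranges of the links decay geometrically, so no factor `log N`
appears. The constant must not depend on `D` or `r`. This works because `p ≤ r (T + 1) (d + W)` is
free of `D`, while `log (3m) ≤ c₀ D log K` (`log_gridSize_le`) and `r D ≤ q`. -/

namespace LoRA

/-- The difference between the mean of `g` and its average over the sample `z`. -/
noncomputable def deviation {𝒵 : Type*} [MeasurableSpace 𝒵] {N : ℕ} (P : Measure 𝒵)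
    (z : Fin N → 𝒵) (g : 𝒵 → ℝ) : ℝ :=
  ∫ x, g x ∂P - (1 / (N : ℝ)) * ∑ n, g (z n)

/-! ### Concentration of empirical means. -/

section Hoeffding

variable {𝒵 : Type*} [MeasurableSpace 𝒵] {N : ℕ}

theorem deviation_sub {P : Measure 𝒵} {z : Fin N → 𝒵} {f g : 𝒵 → ℝ} (hf : Integrable f P)
    (hg : Integrable g P) :
    deviation P z (fun x => f x - g x) = deviation P z f - deviation P z g := by
  simp only [deviation, integral_sub hf hg, Finset.sum_sub_distrib]
  ring

theorem abs_deviation_le {P : Measure 𝒵} [IsProbabilityMeasure P] {z : Fin N → 𝒵} {g : 𝒵 → ℝ}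
    (hN : 1 ≤ N) {s : ℝ} (hg : ∀ᵐ x ∂P, |g x| ≤ s) (hz : ∀ n, |g (z n)| ≤ s) :
    |deviation P z g| ≤ 2 * s := by
  have hN' : (0 : ℝ) < N := by exact_mod_cast hN
  have h1 : |∫ x, g x ∂P| ≤ s := by
    have := norm_integral_le_of_norm_le_const (μ := P) (f := g) (C := s) (by simpa using hg)
    simpa using this
  have h2 : |(1 / (N : ℝ)) * ∑ n, g (z n)| ≤ s := by
    rw [abs_mul, abs_of_pos (by positivity : (0 : ℝ) < 1 / N), one_div, inv_mul_le_iff₀ hN']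
    calc |∑ n, g (z n)| ≤ ∑ n, |g (z n)| := Finset.abs_sum_le_sum_abs _ _
      _ ≤ ∑ _n : Fin N, s := Finset.sum_le_sum fun n _ => hz n
      _ = N * s := by simp
  unfold deviation
  calc _ ≤ |∫ x, g x ∂P| + |(1 / (N : ℝ)) * ∑ n, g (z n)| := abs_sub _ _
    _ ≤ 2 * s := by linarith

/-- Hoeffding's inequality for the empirical mean of an i.i.d. sample. -/
theorem measureReal_le_abs_deviation (P : Measure 𝒵) [IsProbabilityMeasure P] (hN : 1 ≤ N)
    {g : 𝒵 → ℝ} (hg : Measurable g) {l w t : ℝ} (hw : 0 < w) (ht : 0 ≤ t)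
    (hgb : ∀ᵐ x ∂P, g x ∈ Set.Icc l (l + w)) :
    (Measure.pi fun _ : Fin N => P).real {z | t ≤ |deviation P z g|}
      ≤ 2 * Real.exp (-(2 * N * t ^ 2 / w ^ 2)) := by
  have hN' : (0 : ℝ) < N := by exact_mod_cast hN
  set Q := Measure.pi fun _ : Fin N => P
  set X : Fin N → (Fin N → 𝒵) → ℝ := fun n z => g (z n) - ∫ x, g x ∂P with hX
  have hind : iIndepFun X Q := by
    have := iIndepFun_pi (μ := fun _ : Fin N => P) (X := fun _ x => g x - ∫ x, g x ∂P)
      (fun _ => by fun_prop)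
    exact this
  have hmp (n : Fin N) : MeasurePreserving (Function.eval n) Q P :=
    measurePreserving_eval (fun _ : Fin N => P) n
  -- Hoeffding's lemma: a centred variable with range of width `w` is sub-Gaussian with variance
  -- proxy `(w / 2) ^ 2`.
  have hsub (n : Fin N) : HasSubgaussianMGF (X n) ((‖w‖₊ / 2) ^ 2) Q := by
    have h1 := hasSubgaussianMGF_of_mem_Icc hg.aemeasurable hgb
    rw [add_sub_cancel_left, ← (hmp n).map_eq] at h1
    have h2 := HasSubgaussianMGF.of_map (hmp n).measurable.aemeasurable h1
    rw [(hmp n).map_eq] at h2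
    exact h2
  have key (Y : Fin N → (Fin N → 𝒵) → ℝ) (hY : iIndepFun Y Q)
      (hYs : ∀ n, HasSubgaussianMGF (Y n) ((‖w‖₊ / 2) ^ 2) Q) :
      Q.real {z | N * t ≤ ∑ n, Y n z} ≤ Real.exp (-(2 * N * t ^ 2 / w ^ 2)) := by
    refine (HasSubgaussianMGF.measure_sum_ge_le_of_iIndepFun hY (s := Finset.univ)
      (c := fun _ => (‖w‖₊ / 2) ^ 2) (fun n _ => hYs n) (by positivity)).trans_eq ?_
    congr 1
    simp only [Finset.sum_const, Finset.card_univ, Fintype.card_fin, nsmul_eq_mul, NNReal.coe_mul,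
      NNReal.coe_natCast, NNReal.coe_pow, NNReal.coe_div, coe_nnnorm, NNReal.coe_ofNat,
      Real.norm_eq_abs, abs_of_pos hw]
    field_simp
  have h1 := key X hind hsub
  have h2 := key (fun n => -X n) (hind.comp (fun _ x => -x) fun _ => measurable_neg)
    fun n => (hsub n).neg
  have hdev (z : Fin N → 𝒵) : N * deviation P z g = -∑ n, X n z := by
    simp only [hX, deviation, Finset.sum_sub_distrib, Finset.sum_const, Finset.card_univ,
      Fintype.card_fin, nsmul_eq_mul]
    field_simp
    ring
  have hsubset : {z : Fin N → 𝒵 | t ≤ |deviation P z g|} ⊆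
      {z | N * t ≤ ∑ n, X n z} ∪ {z | N * t ≤ ∑ n, (-X n) z} := by
    intro z hz
    simp only [Set.mem_ofPred_eq, Set.mem_union, Pi.neg_apply, Finset.sum_neg_distrib,
      ← hdev] at hz ⊢
    rw [le_abs'] at hz
    rcases hz with hz | hz
    · left
      have := hdev z
      nlinarith
    · right
      nlinarith
  calc _ ≤ _ := measureReal_mono hsubset
    _ ≤ _ := measureReal_union_le _ _
    _ ≤ _ := by linarith

/-- Hoeffding's inequality for a random function that is independent of the sample. -/
theorem measure_le_abs_deviation_of_indepFun {Ω β : Type*} [MeasurableSpace Ω]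
    [MeasurableSpace β] {μ : Measure Ω} [IsProbabilityMeasure μ] (P : Measure 𝒵)
    [IsProbabilityMeasure P] (hN : 1 ≤ N) {B : Ω → β} {Z : Fin N → Ω → 𝒵}
    (hB : AEMeasurable B μ) (hZ : ∀ n, HasLaw (Z n) P μ) (hZi : iIndepFun Z μ)
    (hBZ : IndepFun B (fun ω n => Z n ω) μ) {φ : β → 𝒵 → ℝ}
    (hφ : Measurable (Function.uncurry φ)) {S : Set β} (hS : MeasurableSet S) {l w t : ℝ}
    (hw : 0 < w) (ht : 0 ≤ t) (hφb : ∀ b ∈ S, ∀ᵐ x ∂P, φ b x ∈ Set.Icc l (l + w)) :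
    μ {ω | B ω ∈ S ∧ t ≤ |deviation P (fun n => Z n ω) (φ (B ω))|}
      ≤ ENNReal.ofReal (2 * Real.exp (-(2 * N * t ^ 2 / w ^ 2))) := by
  have hZm : AEMeasurable (fun ω n => Z n ω) μ :=
    aemeasurable_pi_lambda _ fun n => (hZ n).aemeasurable
  have hlaw : μ.map (fun ω n => Z n ω) = Measure.pi fun _ => P := by
    rw [hZi.map_fun_eq_pi_map fun n => (hZ n).aemeasurable]
    simp only [(hZ _).map_eq]
  have hprod := hBZ.map_prod_eq_prod_map_map hB hZm
  rw [hlaw] at hprod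
  have := Measure.isProbabilityMeasure_map hB
  set A : Set (β × (Fin N → 𝒵)) := {p | p.1 ∈ S ∧ t ≤ |deviation P p.2 (φ p.1)|} with hA
  have hdevm : Measurable fun p : β × (Fin N → 𝒵) => deviation P p.2 (φ p.1) := by
    unfold deviation
    have h1 : Measurable fun b => ∫ x, φ b x ∂P :=
      (hφ.stronglyMeasurable.integral_prod_right' (ν := P)).measurable
    have h2 (n : Fin N) : Measurable fun p : β × (Fin N → 𝒵) => φ p.1 (p.2 n) :=
      hφ.comp (measurable_fst.prodMk ((measurable_pi_apply n).comp measurable_snd))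
    exact (h1.comp measurable_fst).sub
      ((Finset.measurable_sum _ fun n _ => h2 n).const_mul _)
  have hAm : MeasurableSet A :=
    (measurable_fst hS).inter (measurableSet_le measurable_const hdevm.abs)
  calc μ {ω | B ω ∈ S ∧ t ≤ |deviation P (fun n => Z n ω) (φ (B ω))|}
      = μ.map (fun ω => (B ω, fun n => Z n ω)) A :=
        (Measure.map_apply_of_aemeasurable (hB.prodMk hZm) hAm).symm
    -- By independence and Fubini, `b` is frozen and the inequality for a fixed function applies on
    -- each slice; slices with `b ∉ S` are empty.
    _ = ∫⁻ b, (Measure.pi fun _ : Fin N => P) (Prod.mk b ⁻¹' A) ∂(μ.map B) := by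
        rw [hprod, Measure.prod_apply hAm]
    _ ≤ ∫⁻ _b, ENNReal.ofReal (2 * Real.exp (-(2 * N * t ^ 2 / w ^ 2))) ∂(μ.map B) := by
        refine lintegral_mono fun b => ?_
        by_cases hb : b ∈ S
        · have : Prod.mk b ⁻¹' A = {z | t ≤ |deviation P z (φ b)|} := by
            ext z; simp [hA, hb]
          rw [this, ← ENNReal.ofReal_toReal (measure_ne_top _ _)]
          exact ENNReal.ofReal_le_ofReal (measureReal_le_abs_deviation P hN
            (hφ.comp measurable_prodMk_left) hw ht (hφb b hb))
        · have : Prod.mk b ⁻¹' A = ∅ := by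
            ext z; simp [hA, hb]
          simp [this]
    _ = _ := by simp

end Hoeffding

end LoRA

/-! ### Chaining along dyadic grids. -/

namespace LoRA

/-- Rounding the coordinates down to multiples of `1 / n`. -/
noncomputable def gridRound {ι : Type*} (n : ℕ) (a : ι → ℝ) : ι → ℝ := fun i => (⌊a i * n⌋ : ℝ) / n

theorem gridRound_le {ι : Type*} {n : ℕ} (hn : 0 < n) (a : ι → ℝ) (i : ι) : gridRound n a i ≤ a i := by
  have hn' : (0 : ℝ) < n := by exact_mod_cast hn
  rw [gridRound, div_le_iff₀ hn']
  exact Int.floor_le _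

theorem sub_le_gridRound {ι : Type*} {n : ℕ} (hn : 0 < n) (a : ι → ℝ) (i : ι) :
    a i - 1 / n ≤ gridRound n a i := by
  have hn' : (0 : ℝ) < n := by exact_mod_cast hn
  rw [gridRound, le_div_iff₀ hn', sub_mul, one_div_mul_cancel hn'.ne']
  exact (Int.sub_one_lt_floor _).le

section Grid

variable {ι : Type*} [Fintype ι] [DecidableEq ι]

/-- The points of `[-1, 1]^ι` with coordinates in `n⁻¹ ℤ`. -/
noncomputable def grid (ι : Type*) [Fintype ι] [DecidableEq ι] (n : ℕ) : Finset (ι → ℝ) :=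
  Fintype.piFinset fun _ => (Finset.Icc (-n : ℤ) n).image fun j : ℤ => (j : ℝ) / n

theorem card_grid_le (n : ℕ) : ((grid ι n).card : ℝ) ≤ (2 * n + 1) ^ Fintype.card ι := by
  have h : (grid ι n).card ≤ (2 * n + 1) ^ Fintype.card ι := by
    rw [grid, Fintype.card_piFinset, Finset.prod_const, Finset.card_univ]
    refine Nat.pow_le_pow_left (Finset.card_image_le.trans ?_) _
    rw [Int.card_Icc]
    omega
  exact_mod_cast h

theorem gridRound_mem_grid {n : ℕ} {a : ι → ℝ} (ha : ∀ i, |a i| ≤ 1) :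
    gridRound n a ∈ grid ι n := by
  refine Fintype.mem_piFinset.2 fun i => Finset.mem_image.2 ⟨⌊a i * n⌋, ?_, rfl⟩
  have h := abs_le.1 (ha i)
  have hn : (0 : ℝ) ≤ n := n.cast_nonneg
  rw [Finset.mem_Icc]
  constructor
  · rw [Int.le_floor]
    push_cast
    nlinarith
  · have : (⌊a i * n⌋ : ℝ) ≤ n := (Int.floor_le _).trans (by nlinarith)
    exact_mod_cast this

theorem abs_le_one_of_mem_grid {n : ℕ} {g : ι → ℝ} (hg : g ∈ grid ι n) (i : ι) : |g i| ≤ 1 := by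
  obtain ⟨j, hj, hji⟩ := Finset.mem_image.1 (Fintype.mem_piFinset.1 hg i)
  rw [Finset.mem_Icc] at hj
  rw [← hji, abs_div, Nat.abs_cast]
  refine div_le_one_of_le₀ (abs_le.2 ⟨?_, ?_⟩) n.cast_nonneg
  · exact_mod_cast hj.1
  · exact_mod_cast hj.2

end Grid

theorem sum_geometric_half_le (n : ℕ) : ∑ k ∈ Finset.range n, ((1 : ℝ) / 2) ^ k ≤ 2 := by
  have h : ∀ n : ℕ, ∑ k ∈ Finset.range n, ((1 : ℝ) / 2) ^ k = 2 - 2 * (1 / 2) ^ n := by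
    intro n
    induction n with
    | zero => simp
    | succ n ih => rw [Finset.sum_range_succ, ih]; ring
  rw [h]
  have : (0 : ℝ) < (1 / 2) ^ n := by positivity
  linarith

theorem sum_succ_mul_geometric_half_le (n : ℕ) :
    ∑ k ∈ Finset.range n, ((k : ℝ) + 1) * (1 / 2) ^ k ≤ 4 := by
  have h : ∀ n : ℕ, ∑ k ∈ Finset.range n, ((k : ℝ) + 1) * (1 / 2) ^ k
      = 4 - 2 * (n + 2) * (1 / 2) ^ n := by
    intro n
    induction n with
    | zero => norm_num
    | succ n ih => rw [Finset.sum_range_succ, ih]; push_cast; ring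
  rw [h]
  have : (0 : ℝ) < 2 * (n + 2) * (1 / 2) ^ n := by positivity
  linarith

/-- The thresholds of the chaining argument sum up to the bound on the uniform deviation. -/
theorem chaining_thresholds_le {u v N : ℝ} (hu : 0 ≤ u) (hv : 0 ≤ v) (hN : 0 < N) (n : ℕ) :
    √((u + 7 * v) / (2 * N))
        + ∑ k ∈ Finset.range n, (1 / 2 : ℝ) ^ k * √((u + 7 * (k + 1) * v) / (2 * N))
      ≤ 10 * √(v / N) + √(8 * u / N) := by
  set a := √(u / N)
  set b := √(v / N)
  have ha : 0 ≤ a := Real.sqrt_nonneg _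
  have hb : 0 ≤ b := Real.sqrt_nonneg _
  have ha2 : a ^ 2 = u / N := Real.sq_sqrt (by positivity)
  have hb2 : b ^ 2 = v / N := Real.sq_sqrt (by positivity)
  -- `0.8² ≥ 1/2` and `1.9² ≥ 7/2`. Since `√(k + 1)` is replaced by `k + 1`, the levels sum to `0.8
  -- (1 + 2) a + 1.9 (1 + 4) b = 2.4 a + 9.5 b`, and `2.4² ≤ 8`.
  have h1 (k : ℕ) : √((u + 7 * (k + 1) * v) / (2 * N)) ≤ 0.8 * a + 1.9 * ((k + 1) * b) := by
    have hk : (0 : ℝ) ≤ k := k.cast_nonneg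
    refine Real.sqrt_le_iff.2 ⟨by positivity, ?_⟩
    have : (u + 7 * (k + 1) * v) / (2 * N) = a ^ 2 / 2 + 7 / 2 * (k + 1) * b ^ 2 := by
      rw [ha2, hb2]; field_simp
    rw [this]
    nlinarith [mul_nonneg ha hb, mul_nonneg hk (sq_nonneg b),
      mul_nonneg (mul_nonneg hk hk) (sq_nonneg b), mul_nonneg hk (mul_nonneg ha hb), sq_nonneg a]
  have h0 : √((u + 7 * v) / (2 * N)) ≤ 0.8 * a + 1.9 * b := by simpa using h1 0
  have h2 : ∑ k ∈ Finset.range n, (1 / 2 : ℝ) ^ k * √((u + 7 * (k + 1) * v) / (2 * N))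
      ≤ 0.8 * a * 2 + 1.9 * b * 4 := by
    calc _ ≤ ∑ k ∈ Finset.range n, (0.8 * a * (1 / 2) ^ k
            + 1.9 * b * (((k : ℝ) + 1) * (1 / 2) ^ k)) := by
          refine Finset.sum_le_sum fun k _ => ?_
          have := mul_le_mul_of_nonneg_left (h1 k) (by positivity : (0 : ℝ) ≤ (1 / 2) ^ k)
          linarith
      _ ≤ _ := by
          rw [Finset.sum_add_distrib, ← Finset.mul_sum, ← Finset.mul_sum]
          exact add_le_add (mul_le_mul_of_nonneg_left (sum_geometric_half_le n) (by positivity))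
            (mul_le_mul_of_nonneg_left (sum_succ_mul_geometric_half_le n) (by positivity))
  have h3 : 2.4 * a ≤ √(8 * u / N) := by
    refine Real.le_sqrt_of_sq_le ?_
    have : 8 * u / N = 8 * a ^ 2 := by rw [ha2]; ring
    rw [this]
    nlinarith [sq_nonneg a]
  linarith

/-- The number of pairs of consecutive grid points, times the failure probability of a pair. -/
theorem grid_card_mul_exp_le {p m k : ℕ} (hp : 1 ≤ p) (hm : 1 ≤ m) (u : ℝ) :
    ((2 * (m * 2 ^ k : ℕ) + 1 : ℝ) ^ p * (2 * (m * 2 ^ (k + 1) : ℕ) + 1 : ℝ) ^ p)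
        * (2 * Real.exp (-(u + 7 * (k + 1) * (p * Real.log (3 * m)))))
      ≤ Real.exp (-u) * (1 / 2) ^ (k + 2) := by
  have hm' : (1 : ℝ) ≤ m := by exact_mod_cast hm
  have hp' : (1 : ℝ) ≤ p := by exact_mod_cast hp
  set v := Real.log (3 * m) with hv
  have hk : (0 : ℝ) ≤ k := k.cast_nonneg
  have hv1 : 1 ≤ v := by
    rw [hv, Real.le_log_iff_exp_le (by positivity)]
    linarith [Real.exp_one_lt_d9]
  have hl2 : Real.log 2 ≤ 1 := by linarith [Real.log_two_lt_d9]
  have hl2' : 0 ≤ Real.log 2 := Real.log_nonneg (by norm_num)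
  have h2 : Real.exp (Real.log 2) = 2 := Real.exp_log (by norm_num)
  have hb (j : ℕ) (hj : (j : ℝ) ≤ k + 1) :
      (2 * (m * 2 ^ j : ℕ) + 1 : ℝ) ^ p ≤ Real.exp (p * (v + (k + 1))) := by
    rw [Real.exp_nat_mul]
    refine pow_le_pow_left₀ (by positivity) ?_ p
    have h1 : (1 : ℝ) ≤ m * 2 ^ j := one_le_mul_of_one_le_of_one_le hm' (one_le_pow₀ (by norm_num))
    calc (2 * (m * 2 ^ j : ℕ) + 1 : ℝ) ≤ 3 * m * 2 ^ j := by push_cast; linarith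
      _ = Real.exp (v + j * Real.log 2) := by
          rw [Real.exp_add, Real.exp_nat_mul, h2, hv, Real.exp_log (by positivity)]
      _ ≤ _ := by
          refine Real.exp_le_exp.2 (by nlinarith [(j.cast_nonneg : (0 : ℝ) ≤ j)])
  have hhalf : Real.exp (-(k + 2 : ℝ)) ≤ (1 / 2) ^ (k + 2) := by
    have : (1 / 2 : ℝ) ^ (k + 2) = Real.exp (-((k + 2 : ℕ) * Real.log 2)) := by
      rw [Real.exp_neg, Real.exp_nat_mul, h2, one_div, inv_pow]
    rw [this]
    refine Real.exp_le_exp.2 ?_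
    push_cast
    nlinarith
  calc _ ≤ (Real.exp (p * (v + (k + 1))) * Real.exp (p * (v + (k + 1))))
        * (Real.exp 1 * Real.exp (-(u + 7 * (k + 1) * (p * v)))) := by
        gcongr
        · exact hb k (by linarith)
        · exact hb (k + 1) (by push_cast; linarith)
        · linarith [Real.add_one_le_exp (1 : ℝ)]
    _ = Real.exp (2 * p * (v + (k + 1)) + 1 - (u + 7 * (k + 1) * (p * v))) := by
        rw [← Real.exp_add, ← Real.exp_add, ← Real.exp_add]
        congr 1
        ring
    -- Origin of the constant 7: as `p v ≥ 1` and `p ≤ p v`, the cost `2p(v + k + 1) + 1 + (k + 2)`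
    -- is at most `(3k + 7) p v ≤ 7 (k + 1) p v`, with no slack in the last step at `k = 0`.
    _ ≤ Real.exp (-u + -(k + 2 : ℝ)) := by
        refine Real.exp_le_exp.2 ?_
        have hpv : 1 ≤ p * v := one_le_mul_of_one_le_of_one_le hp' hv1
        have hpp : (p : ℝ) ≤ p * v := by nlinarith
        nlinarith [mul_nonneg hk (sub_nonneg.2 hpv), mul_nonneg hk (sub_nonneg.2 hpp)]
    _ ≤ _ := by
        rw [Real.exp_add]
        exact mul_le_mul_of_nonneg_left hhalf (Real.exp_pos _).le

/-- Uniform deviation bound, by chaining along dyadic grids, for a random family of functions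
depending in a Lipschitz way on a parameter in `[-1, 1]^ι`, and independent of the sample. -/
theorem measure_exists_deviation_gt_le {ι Ω β 𝒵 : Type*} [Fintype ι] [Nonempty ι]
    [MeasurableSpace Ω] [MeasurableSpace β] [MeasurableSpace 𝒵] {N : ℕ} {μ : Measure Ω}
    [IsProbabilityMeasure μ] (P : Measure 𝒵) [IsProbabilityMeasure P] (hN : 1 ≤ N) {B : Ω → β}
    {Z : Fin N → Ω → 𝒵} (hB : AEMeasurable B μ) (hZ : ∀ n, HasLaw (Z n) P μ)
    (hZi : iIndepFun Z μ) (hBZ : IndepFun B (fun ω n => Z n ω) μ)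
    {h : β → (ι → ℝ) → 𝒵 → ℝ} (hm : ∀ a, Measurable fun q : β × 𝒵 => h q.1 a q.2)
    (h01 : ∀ b a x, h b a x ∈ Set.Icc (0 : ℝ) 1) {S : Set β} (hS : MeasurableSet S)
    {Zs : Set 𝒵} (hZs : ∀ᵐ x ∂P, x ∈ Zs) {L : ℝ}
    (hLip : ∀ b ∈ S, ∀ x ∈ Zs, ∀ a a' : ι → ℝ, (∀ i, |a i| ≤ 1) → (∀ i, |a' i| ≤ 1) →
      ∀ s, (∀ i, |a i - a' i| ≤ s) → |h b a x - h b a' x| ≤ L * s)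
    {m : ℕ} (hm1 : 1 ≤ m) (hLm : 2 * L ≤ m) {u : ℝ} (hu : 0 ≤ u) :
    μ {ω | B ω ∈ S ∧ ∃ a : ι → ℝ, (∀ i, |a i| ≤ 1) ∧
        10 * √(Fintype.card ι * Real.log (3 * m) / N) + √(8 * u / N)
          < |deviation P (fun n => Z n ω) (h (B ω) a)|}
      ≤ ENNReal.ofReal (Real.exp (-u)) := by
  classical
  have hN' : (0 : ℝ) < N := by exact_mod_cast hN
  have hm' : (1 : ℝ) ≤ m := by exact_mod_cast hm1
  have hp : 1 ≤ Fintype.card ι := Fintype.card_pos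
  set v : ℝ := Fintype.card ι * Real.log (3 * m) with hv
  have hv0 : 0 ≤ v := mul_nonneg (Nat.cast_nonneg _) (Real.log_nonneg (by linarith))
  set size : ℕ → ℕ := fun k => m * 2 ^ k with hsize
  have hsize0 (k) : 0 < size k := by positivity
  -- Chosen so that Hoeffding's exponent `2 N t² / w²` with range `w = (1 / 2) ^ k` equals `u + 7 (k
  -- + 1) v`.
  set t : ℕ → ℝ := fun k => (1 / 2) ^ k * √((u + 7 * (k + 1) * v) / (2 * N)) with ht
  set t₀ : ℝ := √((u + 7 * v) / (2 * N)) with ht₀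
  -- the exceptional events
  set Bad₀ : (ι → ℝ) → Set Ω := fun g =>
    {ω | B ω ∈ S ∧ t₀ ≤ |deviation P (fun n => Z n ω) (h (B ω) g)|} with hBad₀
  -- Closeness is part of the event, so that the union may run over all pairs of grid points:
  -- distant pairs give the empty event.
  set Bad : ℕ → (ι → ℝ) × (ι → ℝ) → Set Ω := fun k g =>
    {ω | (B ω ∈ S ∧ ∀ i, |g.1 i - g.2 i| ≤ 1 / size k) ∧
      t k ≤ |deviation P (fun n => Z n ω) (fun x => h (B ω) g.1 x - h (B ω) g.2 x)|} with hBad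
  set pairs : ℕ → Finset ((ι → ℝ) × (ι → ℝ)) := fun k => grid ι (size k) ×ˢ grid ι (size (k + 1))
    with hpairs
  have hbase (g : ι → ℝ) : μ (Bad₀ g) ≤ ENNReal.ofReal (2 * Real.exp (-(u + 7 * v))) := by
    refine (measure_le_abs_deviation_of_indepFun (l := 0) (w := 1) P hN hB hZ hZi hBZ
      (φ := fun b x => h b g x) (hm g) hS
      one_pos (Real.sqrt_nonneg _) fun b _ => ae_of_all _ fun x => by simpa using h01 b g x).trans
      (le_of_eq ?_)
    rw [Real.sq_sqrt (by positivity)]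
    congr 4
    field_simp
  -- Here `2 L ≤ m` enters: the increment over a link of level `k` takes values in an interval of
  -- width `(1 / 2) ^ k`.
  have hdist (k : ℕ) : L * (1 / size k) ≤ (1 / 2) ^ k / 2 := by
    have : (1 / 2 : ℝ) ^ k = 1 / 2 ^ k := by rw [one_div, inv_pow, one_div]
    rw [this, hsize]
    push_cast
    rw [mul_one_div, div_div, div_le_div_iff₀ (by positivity) (by positivity)]
    nlinarith [(by positivity : (0 : ℝ) < 2 ^ k)]
  have hstep (k : ℕ) (g : (ι → ℝ) × (ι → ℝ)) (hg : g ∈ pairs k) :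
      μ (Bad k g) ≤ ENNReal.ofReal (2 * Real.exp (-(u + 7 * (k + 1) * v))) := by
    rw [hpairs, Finset.mem_product] at hg
    by_cases hclose : ∀ i, |g.1 i - g.2 i| ≤ 1 / size k
    · simp only [hBad, hclose, implies_true, and_true]
      refine (measure_le_abs_deviation_of_indepFun (l := -((1 / 2) ^ k / 2)) (w := (1 / 2) ^ k)
        P hN hB hZ hZi hBZ (φ := fun b x => h b g.1 x - h b g.2 x) ((hm g.1).sub (hm g.2)) hS
        (by positivity) (by positivity) fun b hb => ?_).trans (le_of_eq ?_)
      · filter_upwards [hZs] with x hx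
        have h1 := (hLip b hb x hx g.1 g.2 (abs_le_one_of_mem_grid hg.1)
          (abs_le_one_of_mem_grid hg.2) _ hclose).trans (hdist k)
        rw [abs_le] at h1
        exact ⟨h1.1, by linarith [h1.2]⟩
      · simp only [ht]
        rw [mul_pow, Real.sq_sqrt (by positivity)]
        congr 4
        field_simp
    · have : Bad k g = ∅ := by
        ext ω
        simp only [hBad, hclose, and_false, false_and, Set.mem_ofPred_eq, Set.mem_empty_iff_false]
      simp [this]
  -- the union of all of them is small
  have hcard (k : ℕ) : ∑ g ∈ pairs k, μ (Bad k g)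
      ≤ ENNReal.ofReal (Real.exp (-u) * (1 / 2) ^ (k + 2)) := by
    refine (Finset.sum_le_card_nsmul _ _ _ (hstep k)).trans ?_
    rw [nsmul_eq_mul, ← ENNReal.ofReal_natCast, ← ENNReal.ofReal_mul (Nat.cast_nonneg _)]
    refine ENNReal.ofReal_le_ofReal (le_trans ?_ (grid_card_mul_exp_le (k := k) hp hm1 u))
    refine mul_le_mul_of_nonneg_right ?_ (by positivity)
    rw [hpairs, Finset.card_product]
    push_cast
    refine mul_le_mul ?_ ?_ (Nat.cast_nonneg _) (by positivity)
    · simpa [hsize] using card_grid_le (ι := ι) (size k)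
    · simpa [hsize] using card_grid_le (ι := ι) (size (k + 1))
  have hcard₀ : ∑ g ∈ grid ι (size 0), μ (Bad₀ g)
      ≤ ENNReal.ofReal (Real.exp (-u) * (1 / 2) ^ 2) := by
    refine (Finset.sum_le_card_nsmul _ _ _ fun g _ => hbase g).trans ?_
    rw [nsmul_eq_mul, ← ENNReal.ofReal_natCast, ← ENNReal.ofReal_mul (Nat.cast_nonneg _)]
    -- The base level has one grid only; the count of pairs at level 0 is more than enough.
    refine ENNReal.ofReal_le_ofReal (le_trans ?_ (grid_card_mul_exp_le (k := 0) hp hm1 u))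
    simp only [Nat.cast_zero, zero_add, mul_one]
    refine mul_le_mul_of_nonneg_right ?_ (by positivity)
    refine (card_grid_le (ι := ι) (size 0)).trans
      (le_mul_of_one_le_right (by positivity) (one_le_pow₀ ?_))
    have : (0 : ℝ) ≤ (m * 2 ^ 1 : ℕ) := Nat.cast_nonneg _
    linarith
  have hnull : μ {ω | ¬ ∀ n, Z n ω ∈ Zs} = 0 := by
    rw [← ae_iff, ae_all_iff]
    intro n
    have := hZs
    rw [← (hZ n).map_eq] at this
    exact ae_of_ae_map (hZ n).aemeasurable this
  set Exc : Set Ω := {ω | ¬ ∀ n, Z n ω ∈ Zs} ∪ ((⋃ g ∈ grid ι (size 0), Bad₀ g) ∪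
    ⋃ k, ⋃ g ∈ pairs k, Bad k g) with hExc
  have hExcμ : μ Exc ≤ ENNReal.ofReal (Real.exp (-u)) := by
    calc μ Exc ≤ 0 + (∑ g ∈ grid ι (size 0), μ (Bad₀ g) + ∑' k, ∑ g ∈ pairs k, μ (Bad k g)) := by
          refine (measure_union_le _ _).trans (add_le_add hnull.le ((measure_union_le _ _).trans
            (add_le_add (measure_biUnion_finset_le _ _) ((measure_iUnion_le _).trans ?_))))
          exact ENNReal.tsum_le_tsum fun k => measure_biUnion_finset_le _ _
      _ ≤ ENNReal.ofReal (Real.exp (-u) * (1 / 2) ^ 2)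
          + ∑' k : ℕ, ENNReal.ofReal (Real.exp (-u) * (1 / 2) ^ (k + 2)) := by
          rw [zero_add]
          exact add_le_add hcard₀ (ENNReal.tsum_le_tsum hcard)
      _ ≤ ENNReal.ofReal (Real.exp (-u)) := by
          -- The levels contribute `exp (-u) / 2` and the base `exp (-u) / 4`.
          have hs : HasSum (fun k : ℕ => Real.exp (-u) * (1 / 2 : ℝ) ^ (k + 2))
              (Real.exp (-u) * (1 / 2)) := by
            have := (hasSum_geometric_two).mul_left (Real.exp (-u) * (1 / 4))
            convert! this using 1
            · ext k; ring
            · ring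
          rw [← ENNReal.ofReal_tsum_of_nonneg (fun k => by positivity) hs.summable, hs.tsum_eq,
            ← ENNReal.ofReal_add (by positivity) (by positivity)]
          exact ENNReal.ofReal_le_ofReal (by linarith [Real.exp_pos (-u)])
  -- The event ranges over uncountably many `a`; inclusion in the countable union `Exc` avoids any
  -- measurability question.
  refine (measure_mono ?_).trans hExcμ
  rintro ω ⟨hωS, a, ha, hdev⟩
  by_contra hω
  simp only [hExc, Set.mem_union, Set.mem_iUnion, Set.mem_ofPred_eq, not_or, not_exists,
    not_not, hBad₀, hBad] at hω
  obtain ⟨hωZ, hω₀, hω₁⟩ := hω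
  have hint (g : ι → ℝ) : Integrable (h (B ω) g) P :=
    Integrable.of_mem_Icc 0 1 ((hm g).comp measurable_prodMk_left).aemeasurable
      (ae_of_all _ fun x => h01 _ g x)
  set D : (ι → ℝ) → ℝ := fun g => deviation P (fun n => Z n ω) (h (B ω) g) with hD
  have hchain (n : ℕ) :
      |D (gridRound (size n) a)| ≤ t₀ + ∑ k ∈ Finset.range n, t k := by
    induction n with
    | zero =>
      have := hω₀ _ (gridRound_mem_grid (n := size 0) ha)
      simp only [hωS, true_and, not_le] at this
      simpa using this.le
    | succ n ih =>
      have hcl (i : ι) :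
          |gridRound (size n) a i - gridRound (size (n + 1)) a i| ≤ 1 / size n := by
        have h1 := gridRound_le (hsize0 n) a i
        have h2 := sub_le_gridRound (hsize0 n) a i
        have h3 := gridRound_le (hsize0 (n + 1)) a i
        have h4 := sub_le_gridRound (hsize0 (n + 1)) a i
        have h5 : (1 : ℝ) / size (n + 1) ≤ 1 / size n := by
          refine one_div_le_one_div_of_le (by exact_mod_cast hsize0 n) ?_
          exact_mod_cast Nat.mul_le_mul_left m (Nat.pow_le_pow_right (by norm_num) n.le_succ)
        rw [abs_le]
        constructor <;> linarith
      have := hω₁ n (gridRound (size n) a, gridRound (size (n + 1)) a)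
        (Finset.mem_product.2 ⟨gridRound_mem_grid ha, gridRound_mem_grid ha⟩)
      simp only [hωS, hcl, implies_true, true_and, not_le, deviation_sub (hint _) (hint _)] at this
      rw [Finset.sum_range_succ]
      have h6 := abs_sub_abs_le_abs_sub (D (gridRound (size (n + 1)) a)) (D (gridRound (size n) a))
      rw [abs_sub_comm (D (gridRound (size (n + 1)) a))] at h6
      linarith
  have happrox (n : ℕ) : |D a - D (gridRound (size n) a)| ≤ (1 / 2) ^ n := by
    have hs (x : 𝒵) (hx : x ∈ Zs) :
        |h (B ω) a x - h (B ω) (gridRound (size n) a) x| ≤ (1 / 2) ^ n / 2 := by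
      refine (hLip _ hωS x hx a _ ha (abs_le_one_of_mem_grid (gridRound_mem_grid ha)) (1 / size n)
        fun i => ?_).trans (hdist n)
      have h1 := gridRound_le (hsize0 n) a i
      have h2 := sub_le_gridRound (hsize0 n) a i
      rw [abs_le]
      constructor <;> linarith [(by positivity : (0 : ℝ) ≤ 1 / size n)]
    rw [hD]
    simp only
    rw [← deviation_sub (hint _) (hint _)]
    refine (abs_deviation_le hN (hZs.mono hs) fun i => hs _ (hωZ i)).trans (by linarith)
  have hle (n : ℕ) : |D a| ≤ 10 * √(v / N) + √(8 * u / N) + (1 / 2) ^ n := by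
    have h1 := hchain n
    have h2 := happrox n
    have h3 := chaining_thresholds_le hu hv0 hN' n
    have h4 := abs_sub_abs_le_abs_sub (D a) (D (gridRound (size n) a))
    linarith
  -- All levels are controlled simultaneously, so the discretization error vanishes in the limit.
  have hlim : Filter.Tendsto (fun n : ℕ => 10 * √(v / N) + √(8 * u / N) + (1 / 2 : ℝ) ^ n)
      Filter.atTop (nhds (10 * √(v / N) + √(8 * u / N) + 0)) :=
    (tendsto_pow_atTop_nhds_zero_of_lt_one (by norm_num) (by norm_num)).const_add _
  have := ge_of_tendsto' hlim hle
  linarith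

end LoRA

/-! ### Lipschitz dependence of the network on the trainable entries. -/

namespace LoRA

theorem abs_mulVec_le {m n : ℕ} {A : Matrix (Fin m) (Fin n) ℝ} {x : Fin n → ℝ} {H X : ℝ}
    (hA : ∀ i j, |A i j| ≤ H) (hx : ∀ j, |x j| ≤ X) (hH : 0 ≤ H) (i : Fin m) :
    |(A *ᵥ x) i| ≤ n * (H * X) := by
  rw [Matrix.mulVec, dotProduct]
  calc |∑ j, A i j * x j| ≤ ∑ j, |A i j * x j| := Finset.abs_sum_le_sum_abs _ _
    _ ≤ ∑ _j : Fin n, H * X := Finset.sum_le_sum fun j _ => by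
        rw [abs_mul]
        exact mul_le_mul (hA i j) (hx j) (abs_nonneg _) hH
    _ = n * (H * X) := by simp

theorem abs_mulVec_sub_mulVec_le {m n : ℕ} {A A' : Matrix (Fin m) (Fin n) ℝ} {x x' : Fin n → ℝ}
    {H X e δ : ℝ} (hA : ∀ i j, |A i j| ≤ H) (hx' : ∀ j, |x' j| ≤ X)
    (hAA' : ∀ i j, |A i j - A' i j| ≤ e) (hxx' : ∀ j, |x j - x' j| ≤ δ) (hH : 0 ≤ H) (he : 0 ≤ e)
    (i : Fin m) : |(A *ᵥ x) i - (A' *ᵥ x') i| ≤ n * (H * δ + e * X) := by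
  have h : (A *ᵥ x) i - (A' *ᵥ x') i = (A *ᵥ (x - x')) i + ((A - A') *ᵥ x') i := by
    simp only [Matrix.mulVec_sub, Matrix.sub_mulVec, Pi.sub_apply]
    ring
  rw [h]
  calc _ ≤ |(A *ᵥ (x - x')) i| + |((A - A') *ᵥ x') i| := abs_add_le _ _
    _ ≤ n * (H * δ) + n * (e * X) :=
        add_le_add (abs_mulVec_le hA hxx' hH i) (abs_mulVec_le hAA' hx' he i)
    _ = _ := by ring

theorem inDim_le (d W t : ℕ) : (inDim d W t : ℝ) ≤ d + W := by
  cases t <;> simp [inDim]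

section Network

variable {d D T W : ℕ}

/-- All weights and biases are at most `H` in absolute value. -/
structure Params.EntriesLE (θ : Params d D T W) (H : ℝ) : Prop where
  hiddenWeight : ∀ t i j, |θ.hiddenWeight t i j| ≤ H
  hiddenBias : ∀ t i, |θ.hiddenBias t i| ≤ H
  outWeight : ∀ i j, |θ.outWeight i j| ≤ H

/-- The biases coincide, and the weights differ by at most `e`. -/
structure Params.WeightsClose (θ θ' : Params d D T W) (e : ℝ) : Prop where
  hiddenWeight : ∀ t i j, |θ.hiddenWeight t i j - θ'.hiddenWeight t i j| ≤ e
  hiddenBias : θ.hiddenBias = θ'.hiddenBias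
  outWeight : ∀ i j, |θ.outWeight i j - θ'.outWeight i j| ≤ e
  outBias : θ.outBias = θ'.outBias

theorem Params.entriesLE_supNorm (θ : Params d D T W) : θ.EntriesLE θ.supNorm where
  hiddenWeight t i j := by
    refine le_trans ?_ ((le_max_left _ _).trans (le_max_left _ _))
    exact ((norm_le_pi_norm (θ.hiddenWeight t i) j).trans (norm_le_pi_norm (fun i j =>
      θ.hiddenWeight t i j : Fin W → Fin (inDim d W t) → ℝ) i)).trans
      (norm_le_pi_norm (fun t i j => θ.hiddenWeight t i j :
        (t : Fin T) → Fin W → Fin (inDim d W t) → ℝ) t)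
  hiddenBias t i := by
    refine le_trans ?_ ((le_max_right _ _).trans (le_max_left _ _))
    exact (norm_le_pi_norm (θ.hiddenBias t) i).trans (norm_le_pi_norm _ t)
  outWeight i j := by
    refine le_trans ?_ ((le_max_left _ _).trans (le_max_right _ _))
    exact (norm_le_pi_norm (θ.outWeight i) j).trans (norm_le_pi_norm (fun i j =>
      θ.outWeight i j : Fin D → Fin (inDim d W T) → ℝ) i)

theorem Params.supNorm_nonneg (θ : Params d D T W) : 0 ≤ θ.supNorm :=
  (norm_nonneg _).trans ((le_max_left _ _).trans (le_max_left _ _))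

variable {σ : ℝ → ℝ} {C H : ℝ}

theorem abs_activation_le (hσ : ∀ x y, |σ x - σ y| ≤ C * |x - y|) (hσ0 : |σ 0| ≤ C) (x : ℝ) :
    |σ x| ≤ C * (1 + |x|) := by
  have h1 := hσ x 0
  rw [sub_zero] at h1
  have h2 := abs_sub_abs_le_abs_sub (σ x) (σ 0)
  linarith

/-- Growth per layer: `d + W` for the row sums, 1 for the bias and 1 for the constant in `|σ x| ≤ C
(1 + |x|)`. -/
theorem abs_layerInput_le (hσ : ∀ x y, |σ x - σ y| ≤ C * |x - y|) (hσ0 : |σ 0| ≤ C) (hC : 1 ≤ C)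
    (hH : 1 ≤ H) {θ : Params d D T W} (hθ : θ.EntriesLE H) {x : Fin d → ℝ} (hx : ∀ i, |x i| ≤ 1)
    (t : ℕ) (ht : t ≤ T) (i : Fin (inDim d W t)) :
    |layerInput σ θ x t ht i| ≤ (C * ((d + W + 2 : ℝ) * H)) ^ t := by
  set G := C * ((d + W + 2 : ℝ) * H)
  have hG : 1 ≤ G := by
    refine one_le_mul_of_one_le_of_one_le hC (one_le_mul_of_one_le_of_one_le ?_ hH)
    linarith [(Nat.cast_nonneg d : (0 : ℝ) ≤ d), (Nat.cast_nonneg W : (0 : ℝ) ≤ W)]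
  induction t with
  | zero => simpa [layerInput] using hx i
  | succ t ih =>
    have h1 : 1 ≤ G ^ t := one_le_pow₀ hG
    have h2 := abs_mulVec_le (hθ.hiddenWeight ⟨t, ht⟩) (ih (Nat.le_of_succ_le ht))
      (zero_le_one.trans hH) i
    have h3 := hθ.hiddenBias ⟨t, ht⟩ i
    have h4 := inDim_le d W t
    refine (abs_activation_le hσ hσ0 _).trans ?_
    rw [pow_succ', mul_assoc]
    refine mul_le_mul_of_nonneg_left ?_ (by linarith)
    have h5 : (inDim d W t : ℝ) * (H * G ^ t) ≤ (d + W) * (H * G ^ t) :=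
      mul_le_mul_of_nonneg_right h4 (by positivity)
    have h6 : H ≤ H * G ^ t := le_mul_of_one_le_right (by linarith) h1
    have h7 := abs_add_le ((θ.hiddenWeight ⟨t, ht⟩ *ᵥ layerInput σ θ x t (Nat.le_of_succ_le ht)) i)
      (θ.hiddenBias ⟨t, ht⟩ i)
    calc _ ≤ 1 + ((d + W) * (H * G ^ t) + H) := by simp only at h2 h7 ⊢; linarith
      _ ≤ (d + W) * (H * G ^ t) + 2 * (H * G ^ t) := by linarith
      _ = _ := by ring

/-- With `G` the growth factor per layer, the error obeys `e (t + 1) ≤ G (e t + G ^ t s)`, which `t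
G ^ t s` solves. Weight changes are measured as `H * s` so that `H` factors out. -/
theorem abs_layerInput_sub_le (hσ : ∀ x y, |σ x - σ y| ≤ C * |x - y|) (hσ0 : |σ 0| ≤ C)
    (hC : 1 ≤ C) (hH : 1 ≤ H) {θ θ' : Params d D T W} (hθ : θ.EntriesLE H) (hθ' : θ'.EntriesLE H)
    {s : ℝ} (hs : 0 ≤ s) (hθθ' : θ.WeightsClose θ' (H * s)) {x : Fin d → ℝ}
    (hx : ∀ i, |x i| ≤ 1) (t : ℕ) (ht : t ≤ T) (i : Fin (inDim d W t)) :
    |layerInput σ θ x t ht i - layerInput σ θ' x t ht i|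
      ≤ t * (C * ((d + W + 2 : ℝ) * H)) ^ t * s := by
  set G := C * ((d + W + 2 : ℝ) * H) with hGdef
  have hG : 1 ≤ G := by
    refine one_le_mul_of_one_le_of_one_le hC (one_le_mul_of_one_le_of_one_le ?_ hH)
    linarith [(Nat.cast_nonneg d : (0 : ℝ) ≤ d), (Nat.cast_nonneg W : (0 : ℝ) ≤ W)]
  induction t with
  | zero => simp [layerInput]
  | succ t ih =>
    have h2 := abs_mulVec_sub_mulVec_le (hθ.hiddenWeight ⟨t, ht⟩)
      (abs_layerInput_le hσ hσ0 hC hH hθ' hx t (Nat.le_of_succ_le ht))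
      (hθθ'.hiddenWeight ⟨t, ht⟩) (ih (Nat.le_of_succ_le ht)) (zero_le_one.trans hH)
      (by positivity) i
    rw [← hGdef] at h2
    refine (hσ _ _).trans ?_
    rw [hθθ'.hiddenBias, add_sub_add_right_eq_sub]
    have h4 : (inDim d W t : ℝ) ≤ d + W + 2 := by linarith [inDim_le d W t]
    calc C * _ ≤ C * ((inDim d W t : ℝ) * (H * (t * G ^ t * s) + H * s * G ^ t)) :=
          mul_le_mul_of_nonneg_left h2 (by linarith)
      _ ≤ C * ((d + W + 2 : ℝ) * (H * (t * G ^ t * s) + H * s * G ^ t)) :=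
          mul_le_mul_of_nonneg_left (mul_le_mul_of_nonneg_right h4 (by positivity)) (by linarith)
      _ = _ := by rw [pow_succ]; push_cast; rw [hGdef]; ring

theorem dist_mlp_le (hσ : ∀ x y, |σ x - σ y| ≤ C * |x - y|) (hσ0 : |σ 0| ≤ C)
    (hC : 1 ≤ C) (hH : 1 ≤ H) {θ θ' : Params d D T W} (hθ : θ.EntriesLE H) (hθ' : θ'.EntriesLE H)
    {s : ℝ} (hs : 0 ≤ s) (hθθ' : θ.WeightsClose θ' (H * s)) {x : E d} (hx : ∀ i, |x i| ≤ 1) :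
    dist (mlp σ θ x) (mlp σ θ' x) ≤ D * (T + 1) * (C * ((d + W + 2 : ℝ) * H)) ^ (T + 1) * s := by
  set G := C * ((d + W + 2 : ℝ) * H) with hGdef
  have hG : 1 ≤ G := by
    refine one_le_mul_of_one_le_of_one_le hC (one_le_mul_of_one_le_of_one_le ?_ hH)
    linarith [(Nat.cast_nonneg d : (0 : ℝ) ≤ d), (Nat.cast_nonneg W : (0 : ℝ) ≤ W)]
  have hc (i : Fin D) : |mlp σ θ x i - mlp σ θ' x i| ≤ (T + 1) * G ^ (T + 1) * s := by
    have h2 := abs_mulVec_sub_mulVec_le hθ.outWeight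
      (abs_layerInput_le hσ hσ0 hC hH hθ' hx T le_rfl)
      hθθ'.outWeight (abs_layerInput_sub_le hσ hσ0 hC hH hθ hθ' hs hθθ' hx T le_rfl)
      (zero_le_one.trans hH) (by positivity) i
    rw [← hGdef] at h2
    simp only [mlp, Pi.add_apply, hθθ'.outBias, add_sub_add_right_eq_sub]
    have h4 : (inDim d W T : ℝ) ≤ d + W + 2 := by linarith [inDim_le d W T]
    calc _ ≤ (inDim d W T : ℝ) * (H * (T * G ^ T * s) + H * s * G ^ T) := h2
      _ ≤ (d + W + 2 : ℝ) * (H * (T * G ^ T * s) + H * s * G ^ T) :=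
          mul_le_mul_of_nonneg_right h4 (by positivity)
      -- The output layer has no activation; `C ≥ 1` is inserted to complete the power `G ^ (T +
      -- 1)`.
      _ ≤ C * ((d + W + 2 : ℝ) * (H * (T * G ^ T * s) + H * s * G ^ T)) :=
          le_mul_of_one_le_left (by positivity) hC
      _ = _ := by rw [pow_succ, hGdef]; ring
  rw [EuclideanSpace.dist_eq]
  refine Real.sqrt_le_iff.2 ⟨by positivity, ?_⟩
  set c := (T + 1) * G ^ (T + 1) * s with hcdef
  have hD : (D : ℝ) ≤ D ^ 2 := by exact_mod_cast Nat.le_self_pow (by norm_num) D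
  calc ∑ i, dist (mlp σ θ x i) (mlp σ θ' x i) ^ 2 ≤ ∑ _i : Fin D, c ^ 2 :=
        Finset.sum_le_sum fun i _ => by
          rw [Real.dist_eq]
          exact pow_le_pow_left₀ (abs_nonneg _) (hc i) 2
    _ = D * c ^ 2 := by simp
    _ ≤ D ^ 2 * c ^ 2 := mul_le_mul_of_nonneg_right hD (sq_nonneg _)
    _ = _ := by rw [hcdef]; ring

end Network

/-- One constant serves as Lipschitz constant, as bound for `|σ 0|` (hence linear growth), and is at
least 1. -/
theorem AdmissibleActivation.exists_lipschitz {σ : ℝ → ℝ} (hσ : AdmissibleActivation σ) :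
    ∃ C : ℝ, 1 ≤ C ∧ (∀ x y, |σ x - σ y| ≤ C * |x - y|) ∧ |σ 0| ≤ C := by
  have h : ∃ K : ℝ≥0, LipschitzWith K σ := by
    rcases hσ with ⟨h, -⟩ | rfl
    · exact h
    · exact ⟨1, LipschitzWith.id.max_const 0⟩
  obtain ⟨K, hK⟩ := h
  refine ⟨max 1 (max K |σ 0|), le_max_left _ _, fun x y => ?_,
    (le_max_right _ _).trans (le_max_right _ _)⟩
  have := hK.dist_le_mul x y
  rw [Real.dist_eq, Real.dist_eq] at this
  exact this.trans (mul_le_mul_of_nonneg_right ((le_max_left _ _).trans (le_max_right _ _))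
    (abs_nonneg _))

section LowRank

variable {d D T W r : ℕ}

/-- Positions of the entries of the trainable factors. -/
abbrev TrainIdx (d T W r : ℕ) : Type :=
  (Σ t : Fin T, Fin r × Fin (inDim d W t)) ⊕ (Fin r × Fin (inDim d W T))

/-- The trainable factors with entries `M * a`. -/
def trainableOf (M : ℝ) (a : TrainIdx d T W r → ℝ) : Trainable d T W r where
  hidden t := Matrix.of fun k j => M * a (Sum.inl ⟨t, k, j⟩)
  out := Matrix.of fun k j => M * a (Sum.inr (k, j))

/-- Identifies the trainable factors with a unit cube; `M` moves into the Lipschitz constant. -/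
theorem exists_trainableOf {M : ℝ} (hM : 0 < M) {a : Trainable d T W r} (ha : a.BoundedBy M) :
    ∃ a' : TrainIdx d T W r → ℝ, (∀ e, |a' e| ≤ 1) ∧ trainableOf M a' = a := by
  refine ⟨Sum.elim (fun e => a.hidden e.1 e.2.1 e.2.2 / M) fun e => a.out e.1 e.2 / M, ?_, ?_⟩
  · rintro (⟨t, k, j⟩ | ⟨k, j⟩)
    · simpa [abs_div, abs_of_pos hM] using div_le_one_of_le₀ (ha.1 t k j) hM.le
    · simpa [abs_div, abs_of_pos hM] using div_le_one_of_le₀ (ha.2 k j) hM.le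
  · cases a
    simp only [trainableOf, Sum.elim_inl, Sum.elim_inr, mul_div_cancel₀ _ hM.ne']
    rfl

/-- The bound is free of `D`, which leaves room for the factor `D` lost in `log_gridSize_le`. -/
theorem card_trainIdx_le : (Fintype.card (TrainIdx d T W r) : ℝ) ≤ r * ((T + 1) * (d + W)) := by
  simp only [Fintype.card_sum, Fintype.card_sigma, Fintype.card_prod, Fintype.card_fin,
    Nat.cast_add, Nat.cast_sum, Nat.cast_mul]
  have h : ∑ t : Fin T, (r : ℝ) * inDim d W t ≤ ∑ _t : Fin T, (r : ℝ) * (d + W) :=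
    Finset.sum_le_sum fun t _ => mul_le_mul_of_nonneg_left (inDim_le d W t) r.cast_nonneg
  have h' : (r : ℝ) * inDim d W T ≤ r * (d + W) :=
    mul_le_mul_of_nonneg_left (inDim_le d W T) r.cast_nonneg
  simp only [Finset.sum_const, Finset.card_univ, Fintype.card_fin, nsmul_eq_mul] at h
  linarith

theorem abs_mul_apply_le {m n : ℕ} {A : Matrix (Fin m) (Fin r) ℝ} {A' : Matrix (Fin r) (Fin n) ℝ}
    {β s : ℝ} (hA : ∀ i k, |A i k| ≤ β) (hA' : ∀ k j, |A' k j| ≤ s) (hβ : 0 ≤ β) (i : Fin m)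
    (j : Fin n) : |(A * A') i j| ≤ r * β * s := by
  rw [mul_assoc]
  exact abs_mulVec_le hA (fun k => hA' k j) hβ i

variable {θ : Params d D T W} {b : FrozenIdx D T W r → ℝ} {β M : ℝ}

theorem entriesLE_perturb (hb : ∀ e, |b e| ≤ β) (hβ : 0 ≤ β) (hM : 0 ≤ M)
    {a : TrainIdx d T W r → ℝ} (ha : ∀ e, |a e| ≤ 1) :
    (perturb θ b (trainableOf M a)).EntriesLE (1 + θ.supNorm + r * β * M) where
  hiddenWeight t i j := by
    refine (abs_add_le _ _).trans ?_
    have h1 := θ.entriesLE_supNorm.hiddenWeight t i j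
    have h2 := abs_mul_apply_le (A := hiddenFrozen b t) (A' := (trainableOf M a).hidden t) (s := M)
      (fun i k => hb _) (fun k j => by
        simpa [trainableOf, abs_mul, abs_of_nonneg hM] using mul_le_of_le_one_right hM (ha _))
      hβ i j
    linarith
  hiddenBias t i := by
    have : 0 ≤ r * β * M := by positivity
    refine (θ.entriesLE_supNorm.hiddenBias t i).trans ?_
    linarith
  outWeight i j := by
    refine (abs_add_le _ _).trans ?_
    have h1 := θ.entriesLE_supNorm.outWeight i j
    have h2 := abs_mul_apply_le (A := outFrozen b) (A' := (trainableOf M a).out) (s := M)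
      (fun i k => hb _) (fun k j => by
        simpa [trainableOf, abs_mul, abs_of_nonneg hM] using mul_le_of_le_one_right hM (ha _))
      hβ i j
    linarith

theorem weightsClose_perturb (hb : ∀ e, |b e| ≤ β) (hβ : 0 ≤ β) (hM : 0 ≤ M)
    {a a' : TrainIdx d T W r → ℝ} {s : ℝ} (ha : ∀ e, |a e - a' e| ≤ s) :
    (perturb θ b (trainableOf M a)).WeightsClose (perturb θ b (trainableOf M a'))
      (r * β * M * s) where
  hiddenWeight t i j := by
    have h : (perturb θ b (trainableOf M a)).hiddenWeight t i j
        - (perturb θ b (trainableOf M a')).hiddenWeight t i j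
        = (hiddenFrozen b t * ((trainableOf M a).hidden t - (trainableOf M a').hidden t)) i j := by
      simp [perturb, Matrix.mul_sub]
    rw [h, mul_assoc _ M]
    refine abs_mul_apply_le (fun i k => hb _) (fun k j => ?_) hβ i j
    simpa [trainableOf, abs_mul, abs_of_nonneg hM, ← mul_sub] using
      mul_le_mul_of_nonneg_left (ha _) hM
  hiddenBias := rfl
  outWeight i j := by
    have h : (perturb θ b (trainableOf M a)).outWeight i j
        - (perturb θ b (trainableOf M a')).outWeight i j
        = (outFrozen b * ((trainableOf M a).out - (trainableOf M a').out)) i j := by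
      simp [perturb, Matrix.mul_sub]
    rw [h, mul_assoc _ M]
    refine abs_mul_apply_le (fun i k => hb _) (fun k j => ?_) hβ i j
    simpa [trainableOf, abs_mul, abs_of_nonneg hM, ← mul_sub] using
      mul_le_mul_of_nonneg_left (ha _) hM
  outBias := rfl

/-- The fine-tuned network depends continuously on its frozen factors and its input. -/
theorem continuous_mlp_perturb {σ : ℝ → ℝ} (hσ : Continuous σ) (a : Trainable d T W r) :
    Continuous fun p : (FrozenIdx D T W r → ℝ) × E d => mlp σ (perturb θ p.1 a) p.2 := by
  have hfro (t : Fin T) : Continuous fun p : (FrozenIdx D T W r → ℝ) × E d =>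
      hiddenFrozen p.1 t :=
    continuous_matrix fun i k => (continuous_apply (Sum.inl (t, i, k))).comp continuous_fst
  have hout : Continuous fun p : (FrozenIdx D T W r → ℝ) × E d => outFrozen p.1 :=
    continuous_matrix fun i k => (continuous_apply (Sum.inr (i, k))).comp continuous_fst
  have hlayer (t : ℕ) (ht : t ≤ T) : Continuous fun p : (FrozenIdx D T W r → ℝ) × E d =>
      layerInput σ (perturb θ p.1 a) (fun i => p.2 i) t ht := by
    induction t with
    | zero =>
      simp only [layerInput]
      fun_prop
    | succ t ih =>
      refine continuous_pi fun i => hσ.comp (Continuous.add ?_ continuous_const)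
      exact (continuous_apply i).comp (Continuous.matrix_mulVec
        (continuous_const.add ((hfro ⟨t, ht⟩).matrix_mul continuous_const))
        (ih (Nat.le_of_succ_le ht)))
  refine (PiLp.continuous_toLp 2 _).comp (Continuous.add ?_ continuous_const)
  exact Continuous.matrix_mulVec (continuous_const.add (hout.matrix_mul continuous_const))
    (hlayer T le_rfl)

end LowRank

theorem abs_loss_sub_le {D : ℕ} {ℓ : E D → E D → ℝ}
    (hℓ : LipschitzWith 1 fun p : WithLp 2 (E D × E D) => ℓ p.fst p.snd) (y y' z : E D) :
    |ℓ y z - ℓ y' z| ≤ dist y y' := by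
  have := hℓ.dist_le_mul (WithLp.toLp 2 (y, z)) (WithLp.toLp 2 (y', z))
  rw [Real.dist_eq, WithLp.prod_dist_eq_of_L2] at this
  simpa [dist_eq_norm, Real.sqrt_sq] using this

theorem continuous_loss {D : ℕ} {ℓ : E D → E D → ℝ}
    (hℓ : LipschitzWith 1 fun p : WithLp 2 (E D × E D) => ℓ p.fst p.snd) :
    Continuous fun p : E D × E D => ℓ p.1 p.2 :=
  hℓ.continuous.comp (WithLp.prod_continuous_toLp 2 _ _)

end LoRA

/-! ### Gaussian tails and comparison of constants. -/

namespace LoRA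

section Gaussian

variable {Ω : Type*} [MeasurableSpace Ω] {μ : Measure Ω} [IsProbabilityMeasure μ]

theorem measureReal_lt_abs_gaussian_le {X : Ω → ℝ} {ν : ℝ≥0} (hν : 0 < ν)
    (hX : HasLaw X (gaussianReal 0 (ν ^ 2)) μ) {s : ℝ} (hs : 0 ≤ s) :
    μ.real {ω | ν * s < |X ω|} ≤ 2 * Real.exp (-(s ^ 2 / 2)) := by
  have hν' : (0 : ℝ) < ν := hν
  have hsub : HasSubgaussianMGF X (ν ^ 2) μ := by
    refine HasSubgaussianMGF.of_map (X := id) hX.aemeasurable ?_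
    rw [hX.map_eq]
    refine ⟨fun t => integrable_exp_mul_gaussianReal t, fun t => ?_⟩
    rw [mgf_id_gaussianReal]
    simp
  have he : Real.exp (-(ν * s) ^ 2 / (2 * ((ν ^ 2 : ℝ≥0) : ℝ))) = Real.exp (-(s ^ 2 / 2)) := by
    congr 1
    push_cast
    field_simp
  have h1 := hsub.measure_ge_le (ε := ν * s) (by positivity)
  have h2 := hsub.neg.measure_ge_le (ε := ν * s) (by positivity)
  rw [he] at h1 h2
  have hsubset : {ω | ν * s < |X ω|} ⊆ {ω | ν * s ≤ X ω} ∪ {ω | ν * s ≤ (-X) ω} := by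
    intro ω hω
    replace hω : ν * s < |X ω| := hω
    rcases lt_abs.1 hω with h | h
    · exact Or.inl h.le
    · exact Or.inr h.le
  calc _ ≤ _ := measureReal_mono hsubset
    _ ≤ _ := measureReal_union_le _ _
    _ ≤ _ := by linarith

/-- Union bound for the maximum of finitely many centred Gaussian variables. -/
theorem measureReal_exists_lt_abs_gaussian_le {I : Type*} [Fintype I] [Nonempty I]
    {B : I → Ω → ℝ} {ν : ℝ≥0} (hν : 0 < ν) (hB : ∀ e, HasLaw (B e) (gaussianReal 0 (ν ^ 2)) μ)
    {ε : ℝ} (hε : 0 < ε) (hε1 : ε ≤ 1) :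
    μ.real {ω | ¬ ∀ e, |B e ω| ≤ ν * √(2 * Real.log (4 * Fintype.card I / ε))} ≤ ε / 2 := by
  have hn : (1 : ℝ) ≤ Fintype.card I := by exact_mod_cast Fintype.card_pos
  have h1 : 1 ≤ 4 * (Fintype.card I : ℝ) / ε := by
    rw [le_div_iff₀ hε]
    linarith
  have h : {ω | ¬ ∀ e, |B e ω| ≤ ν * √(2 * Real.log (4 * Fintype.card I / ε))}
      = ⋃ e, {ω | ν * √(2 * Real.log (4 * Fintype.card I / ε)) < |B e ω|} := by
    ext ω
    simp
  rw [h]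
  refine (measureReal_iUnion_fintype_le _).trans ((Finset.sum_le_sum fun e _ =>
    measureReal_lt_abs_gaussian_le hν (hB e) (Real.sqrt_nonneg _)).trans_eq ?_)
  -- Each of the `n` variables fails with probability at most `2 · ε / (4n)`.
  rw [Real.sq_sqrt (mul_nonneg zero_le_two (Real.log_nonneg h1)),
    mul_div_cancel_left₀ _ (two_ne_zero' ℝ), Real.exp_neg, Real.exp_log (by positivity)]
  simp only [Finset.sum_const, Finset.card_univ, nsmul_eq_mul]
  field_simp
  norm_num

end Gaussian

theorem epsOf_pos {δ : ℝ} (hδ : 0 < δ) : 0 < epsOf δ := by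
  have : √(1 - δ) < 1 := (Real.sqrt_lt' one_pos).2 (by linarith)
  unfold epsOf
  linarith

theorem epsOf_le_one (δ : ℝ) : epsOf δ ≤ 1 := by
  unfold epsOf
  linarith [Real.sqrt_nonneg (1 - δ)]

theorem epsOf_le_self {δ : ℝ} (hδ : 0 ≤ δ) (hδ1 : δ ≤ 1) : epsOf δ ≤ δ := by
  have : 1 - δ ≤ √(1 - δ) := Real.le_sqrt_of_sq_le (by nlinarith)
  unfold epsOf
  linarith

theorem card_frozenIdx (D T W r : ℕ) :
    (Fintype.card (FrozenIdx D T W r) : ℝ) = r * (T * W + D) := by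
  simp only [Fintype.card_sum, Fintype.card_prod, Fintype.card_fin]
  push_cast
  ring

/-- Comparison of the bound on the perturbation of the weights that holds for all layers at once
with `radius`. -/
theorem perturbation_le_radius {D T W r : ℕ} (hD : 1 ≤ D) (hr : 1 ≤ r) (hrW : r < W) {M ν ε : ℝ}
    (hM : 0 ≤ M) (hν : 0 ≤ ν) (hε : 0 < ε) (hε1 : ε ≤ 1) :
    r * (ν * √(2 * Real.log (4 * (r * (T * W + D)) / ε))) * M
      ≤ 2 * W * (T * W + 1) * D * radius W r M ν ε := by
  have hD' : (1 : ℝ) ≤ D := by exact_mod_cast hD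
  have hr' : (1 : ℝ) ≤ r := by exact_mod_cast hr
  have hrW' : (r : ℝ) ≤ W := by exact_mod_cast hrW.le
  have hW' : (2 : ℝ) ≤ W := by exact_mod_cast (show 2 ≤ W by omega)
  have hT' : (0 : ℝ) ≤ T := T.cast_nonneg
  set l := Real.log (2 * W / ε) with hl
  -- `1 ≤ r < W` forces `W ≥ 2`, so `2 W / ε ≥ 4 > e`.
  have hl1 : 1 ≤ l := by
    rw [hl, Real.le_log_iff_exp_le (by positivity), le_div_iff₀ hε]
    nlinarith [Real.exp_one_lt_d9, Real.exp_pos 1]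
  -- Chosen so that `4 r (T W + D) ≤ 2 W y`; then `log y ≤ y - 1` and `l ≥ 1` give `l + log y ≤ y
  -- l`.
  set y : ℝ := 2 * (T * W + 1) * D with hy
  have hTW : 0 ≤ (T : ℝ) * W := by positivity
  have hy1 : 1 ≤ y := by nlinarith
  have hlog : Real.log (4 * (r * (T * W + D)) / ε) ≤ y * l := by
    calc _ ≤ Real.log (2 * W / ε * y) := by
          refine Real.log_le_log (by positivity) ?_
          rw [div_mul_eq_mul_div]
          refine div_le_div_of_nonneg_right ?_ hε.le
          have : (T : ℝ) * W + D ≤ (T * W + 1) * D := by nlinarith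
          have := mul_le_mul hrW' this (by positivity) (by positivity)
          rw [hy]
          linarith
      _ = l + Real.log y := Real.log_mul (by positivity) (by positivity)
      _ ≤ l + (y - 1) := by linarith [Real.log_le_sub_one_of_pos (by linarith : 0 < y)]
      _ ≤ y * l := by nlinarith
  have hsqrt : r * √(2 * Real.log (4 * (r * (T * W + D)) / ε)) ≤ W * y * √(2 * r * l) := by
    refine abs_le_of_sq_le_sq' ?_ (by positivity) |>.2
    have hlog0 : 0 ≤ Real.log (4 * (r * (T * W + D)) / ε) := by
      refine Real.log_nonneg ?_
      rw [le_div_iff₀ hε]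
      nlinarith
    rw [mul_pow, mul_pow, Real.sq_sqrt (by positivity), Real.sq_sqrt (by positivity)]
    calc (r : ℝ) ^ 2 * (2 * Real.log (4 * (r * (T * W + D)) / ε))
        ≤ r ^ 2 * (2 * (y * l)) := by gcongr
      _ = (r * y) * (2 * r * l) := by ring
      _ ≤ ((W * y) * (W * y)) * (2 * r * l) := by
          refine mul_le_mul_of_nonneg_right ?_ (by positivity)
          have h1 : (r : ℝ) * y ≤ W * y := mul_le_mul_of_nonneg_right hrW' (by linarith)
          have h2 : 1 ≤ W * y := by nlinarith
          nlinarith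
      _ = _ := by ring
  have := mul_le_mul_of_nonneg_left hsqrt (mul_nonneg hM hν)
  unfold radius
  rw [hy] at this
  calc _ = M * ν * (r * √(2 * Real.log (4 * (r * (T * W + D)) / ε))) := by ring
    _ ≤ _ := this
    _ = _ := by ring

/-- The logarithm of the number of grid points per trainable entry. -/
theorem log_gridSize_le {D T : ℕ} (hD : 1 ≤ D) {a K κ L : ℝ} (ha : 1 ≤ a) (hκ : 1 < κ)
    (hK : κ ≤ K) (hL : L = D * (T + 1) * (a * D * K) ^ (T + 1)) :
    Real.log (3 * ⌈2 * L⌉₊)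
      ≤ D * Real.log K * ((Real.log (9 * (T + 1) * a ^ (T + 1)) + (T + 2)) / Real.log κ
        + (T + 1)) := by
  have hD' : (1 : ℝ) ≤ D := by exact_mod_cast hD
  have hT' : (0 : ℝ) ≤ T := T.cast_nonneg
  have hK1 : 1 < K := hκ.trans_le hK
  have hκl : 0 < Real.log κ := Real.log_pos hκ
  have hKl : Real.log κ ≤ Real.log K := Real.log_le_log (by linarith) hK
  have hL1 : 1 ≤ L := by
    rw [hL]
    refine one_le_mul_of_one_le_of_one_le (one_le_mul_of_one_le_of_one_le hD' (by linarith))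
      (one_le_pow₀ (one_le_mul_of_one_le_of_one_le (one_le_mul_of_one_le_of_one_le ha hD') hK1.le))
  have hceil := (Nat.ceil_lt_add_one (by linarith : 0 ≤ 2 * L)).le
  have hceil' := Nat.le_ceil (2 * L)
  set c := Real.log (9 * (T + 1) * a ^ (T + 1)) with hc
  have hc0 : 0 ≤ c := Real.log_nonneg (one_le_mul_of_one_le_of_one_le (by linarith)
    (one_le_pow₀ ha))
  have hDl : Real.log D ≤ D := by linarith [Real.log_le_sub_one_of_pos (by linarith : (0 : ℝ) < D)]
  have h1 : Real.log (3 * ⌈2 * L⌉₊) ≤ c + (T + 2) * Real.log D + (T + 1) * Real.log K := by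
    calc _ ≤ Real.log (9 * L) := Real.log_le_log (by linarith) (by linarith)
      _ = Real.log (9 * (T + 1) * a ^ (T + 1) * D ^ (T + 2) * K ^ (T + 1)) := by
          congr 1
          rw [hL]
          ring
      _ = _ := by
          rw [Real.log_mul (by positivity) (by positivity),
            Real.log_mul (by positivity) (by positivity), Real.log_pow, Real.log_pow]
          push_cast
          ring
  -- The role of `κ`: a lower bound on `log K` turns additive constants into multiples of it.
  have hquot : 1 ≤ Real.log K / Real.log κ := (one_le_div hκl).2 hKl
  have h2 : c + (T + 2) * Real.log D ≤ D * (c + (T + 2)) * (Real.log K / Real.log κ) := by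
    calc c + (T + 2) * Real.log D ≤ D * c + (T + 2) * D :=
          add_le_add (le_mul_of_one_le_left hc0 hD')
            (mul_le_mul_of_nonneg_left hDl (by linarith))
      _ = D * (c + (T + 2)) := by ring
      _ ≤ _ := le_mul_of_one_le_right (by positivity) hquot
  have h3 : (T + 1) * Real.log K ≤ D * ((T + 1) * Real.log K) :=
    le_mul_of_one_le_left (mul_nonneg (by linarith) (by linarith)) hD'
  calc _ ≤ _ := h1
    _ ≤ D * (c + (T + 2)) * (Real.log K / Real.log κ) + D * ((T + 1) * Real.log K) :=
        add_le_add h2 h3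
    _ = _ := by
        field_simp

end LoRA

/-! ### Assembly of the bound. -/

namespace LoRA

theorem continuous_loss_mlp_perturb {d D T W r : ℕ} {σ : ℝ → ℝ} (hσ : Continuous σ)
    {θ : Params d D T W} {a : Trainable d T W r} {ℓ : E D → E D → ℝ}
    (hℓ : LipschitzWith 1 fun p : WithLp 2 (E D × E D) => ℓ p.fst p.snd) :
    Continuous fun q : (FrozenIdx D T W r → ℝ) × (E d × E D) =>
      ℓ (mlp σ (perturb θ q.1 a) q.2.1) q.2.2 := by
  have h : Continuous fun q : (FrozenIdx D T W r → ℝ) × (E d × E D) => (q.1, q.2.1) :=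
    continuous_fst.prodMk (continuous_fst.comp continuous_snd)
  have h' := (continuous_mlp_perturb (θ := θ) hσ a).comp h
  have h'' : Continuous fun q : (FrozenIdx D T W r → ℝ) × (E d × E D) => q.2.2 :=
    continuous_snd.comp continuous_snd
  exact (continuous_loss hℓ).comp (h'.prodMk h'')

/-- High-probability bound for the generalization gap, with an explicit Lipschitz constant `L` of
the loss as a function of the rescaled trainable entries. -/
theorem one_sub_le_measureReal_genGap_le {d D T W r N : ℕ} {σ : ℝ → ℝ} (hd : 1 ≤ d) (hT : 1 ≤ T)
    (hD : 1 ≤ D) (hr : 1 ≤ r) (hW : 1 ≤ W) (hN : 1 ≤ N) {C : ℝ} (hC : 1 ≤ C)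
    (hσ : ∀ x y, |σ x - σ y| ≤ C * |x - y|) (hσ0 : |σ 0| ≤ C) (θ : Params d D T W) {M : ℝ}
    (hM : 0 < M) {ν : ℝ≥0} (hν : 0 < ν) {ℓ : E D → E D → ℝ}
    (hℓ01 : ∀ y y', ℓ y y' ∈ Set.Icc (0 : ℝ) 1)
    (hℓ : LipschitzWith 1 fun p : WithLp 2 (E D × E D) => ℓ p.fst p.snd)
    (P : Measure (E d × E D)) [IsProbabilityMeasure P]
    (hP : ∀ᵐ z ∂P, ∀ i, z.1 i ∈ Set.Icc (0 : ℝ) 1) {Ω : Type*} [MeasurableSpace Ω]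
    {μ : Measure Ω} [IsProbabilityMeasure μ] {B : FrozenIdx D T W r → Ω → ℝ}
    {Z : Fin N → Ω → E d × E D} (hB : ∀ e, HasLaw (B e) (gaussianReal 0 (ν ^ 2)) μ)
    (hZ : ∀ n, HasLaw (Z n) P μ) (hZi : iIndepFun Z μ)
    (hBZ : IndepFun (fun ω e => B e ω) (fun ω n => Z n ω) μ) {ε H L : ℝ} (hε : 0 < ε)
    (hε1 : ε ≤ 1) (hH : 1 + θ.supNorm
      + r * (ν * √(2 * Real.log (4 * (r * (T * W + D)) / ε))) * M ≤ H)
    (hL : L = D * (T + 1) * (C * ((d + W + 2 : ℝ) * H)) ^ (T + 1)) :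
    1 - ε ≤ μ.real {ω | genGap P ℓ (loraClass σ θ M fun e => B e ω) (fun n => Z n ω)
      ≤ 4 * min 1 (5 / 2 * √(r * ((T + 1) * (d + W)) * Real.log (3 * ⌈2 * L⌉₊) / N))
        + √(8 * Real.log (2 / ε) / N)} := by
  have hinT : 0 < inDim d W T := by
    cases T with
    | zero => omega
    | succ T => exact hW
  have : Nonempty (TrainIdx d T W r) := ⟨Sum.inr (⟨0, hr⟩, ⟨0, hinT⟩)⟩
  have : Nonempty (FrozenIdx D T W r) := ⟨Sum.inr (⟨0, hD⟩, ⟨0, hr⟩)⟩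
  set β : ℝ := ν * √(2 * Real.log (4 * (r * (T * W + D)) / ε)) with hβ
  have hβ0 : 0 ≤ β := by positivity
  have hrβM : 0 ≤ r * β * M := by positivity
  have hθ0 := θ.supNorm_nonneg
  have hH1 : 1 ≤ H := by linarith
  have hD' : (1 : ℝ) ≤ D := by exact_mod_cast hD
  have hL0 : 0 < L := by rw [hL]; positivity
  have hm1 : 1 ≤ ⌈2 * L⌉₊ := Nat.ceil_pos.2 (by linarith)
  have hu0 : 0 ≤ Real.log (2 / ε) := Real.log_nonneg (by rw [le_div_iff₀ hε]; linarith)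
  set h : (FrozenIdx D T W r → ℝ) → (TrainIdx d T W r → ℝ) → E d × E D → ℝ :=
    fun b a x => ℓ (mlp σ (perturb θ b (trainableOf M a)) x.1) x.2 with hh
  have hσc : Continuous σ := by
    refine LipschitzWith.continuous (K := ⟨C, by linarith⟩) (LipschitzWith.of_dist_le_mul ?_)
    intro x y
    rw [Real.dist_eq, Real.dist_eq]
    exact hσ x y
  have hmeas (a : TrainIdx d T W r → ℝ) :
      Measurable fun q : (FrozenIdx D T W r → ℝ) × (E d × E D) => h q.1 a q.2 := by
    exact (continuous_loss_mlp_perturb hσc hℓ).measurable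
  set S : Set (FrozenIdx D T W r → ℝ) := {b | ∀ e, |b e| ≤ β} with hS
  have hSm : MeasurableSet S := by
    rw [hS, Set.ofPred_forall]
    exact MeasurableSet.iInter fun e =>
      measurableSet_le (measurable_pi_apply e).abs measurable_const
  have hLip : ∀ b ∈ S, ∀ x ∈ {x : E d × E D | ∀ i, |x.1 i| ≤ 1}, ∀ a a' : TrainIdx d T W r → ℝ,
      (∀ i, |a i| ≤ 1) → (∀ i, |a' i| ≤ 1) → ∀ s, (∀ i, |a i - a' i| ≤ s) →
      |h b a x - h b a' x| ≤ L * s := by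
    intro b hb x hx a a' ha ha' s hs
    have hs0 : 0 ≤ s := (abs_nonneg _).trans (hs (Classical.arbitrary _))
    have hle (θ' : Params d D T W) (h' : θ'.EntriesLE (1 + θ.supNorm + r * β * M)) :
        θ'.EntriesLE H :=
      ⟨fun t i j => (h'.1 t i j).trans hH, fun t i => (h'.2 t i).trans hH,
        fun i j => (h'.3 i j).trans hH⟩
    have hclose := weightsClose_perturb (θ := θ) hb hβ0 hM.le hs
    have hrs : r * β * M * s ≤ H * s := mul_le_mul_of_nonneg_right (by linarith) hs0
    rw [hL]
    exact (abs_loss_sub_le hℓ _ _ _).trans (dist_mlp_le hσ hσ0 hC hH1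
      (hle _ (entriesLE_perturb hb hβ0 hM.le ha)) (hle _ (entriesLE_perturb hb hβ0 hM.le ha')) hs0
      ⟨fun t i j => (hclose.1 t i j).trans hrs, hclose.2,
        fun i j => (hclose.3 i j).trans hrs, hclose.4⟩ hx)
  have hZs : ∀ᵐ x ∂P, x ∈ {x : E d × E D | ∀ i, |x.1 i| ≤ 1} :=
    hP.mono fun x hx i => abs_le.2 ⟨by linarith [(hx i).1], (hx i).2⟩
  have hdev := measure_exists_deviation_gt_le P hN
    (aemeasurable_pi_lambda _ fun e => (hB e).aemeasurable) hZ hZi hBZ hmeas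
    (fun b a x => hℓ01 _ _) hSm hZs hLip hm1 (Nat.le_ceil _) hu0
  have hgauss := measureReal_exists_lt_abs_gaussian_le hν hB hε hε1
  rw [card_frozenIdx, ← hβ] at hgauss
  set Good := {ω | genGap P ℓ (loraClass σ θ M fun e => B e ω) (fun n => Z n ω)
      ≤ 4 * min 1 (5 / 2 * √(r * ((T + 1) * (d + W)) * Real.log (3 * ⌈2 * L⌉₊) / N))
        + √(8 * Real.log (2 / ε) / N)} with hGood
  set Dev := {ω | (fun e => B e ω) ∈ S ∧ ∃ a : TrainIdx d T W r → ℝ, (∀ i, |a i| ≤ 1) ∧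
    10 * √(Fintype.card (TrainIdx d T W r) * Real.log (3 * ⌈2 * L⌉₊) / N)
      + √(8 * Real.log (2 / ε) / N) < |deviation P (fun n => Z n ω) (h (fun e => B e ω) a)|}
  have hdev' : μ.real Dev ≤ ε / 2 := by
    have := ENNReal.toReal_le_of_le_ofReal (Real.exp_pos _).le hdev
    rwa [Real.exp_neg, Real.exp_log (by positivity), inv_div] at this
  -- Covering the whole space and using subadditivity spares the measurability of `Good`, which
  -- involves an uncountable supremum.
  have hcover : Set.univ ⊆ Good ∪ ({ω | ¬ ∀ e, |B e ω| ≤ β} ∪ Dev) := by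
    intro ω _
    by_cases hωS : ∀ e, |B e ω| ≤ β
    swap
    · exact Or.inr (Or.inl hωS)
    by_cases hωD : ω ∈ Dev
    · exact Or.inr (Or.inr hωD)
    left
    simp only [Dev, Set.mem_ofPred_eq, not_and, not_exists, not_lt] at hωD
    replace hωD := hωD hωS
    -- A termwise bound by a nonnegative number suffices, whatever the default value of the real
    -- supremum.
    refine Real.iSup_le ?_ (by positivity)
    rintro ⟨f, a, ha, rfl⟩
    obtain ⟨a', ha', rfl⟩ := exists_trainableOf hM ha
    have h1 := hωD a' ha'
    have h2 : |deviation P (fun n => Z n ω) (h (fun e => B e ω) a')| ≤ 2 * 1 := by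
      have hb (x : E d × E D) : |h (fun e => B e ω) a' x| ≤ 1 :=
        have h3 : h (fun e => B e ω) a' x ∈ Set.Icc (0 : ℝ) 1 := hℓ01 _ _
        abs_le.2 ⟨by linarith [h3.1], h3.2⟩
      exact abs_deviation_le hN (ae_of_all _ hb) fun n => hb _
    change |deviation P (fun n => Z n ω) (h (fun e => B e ω) a')| ≤ _
    have h3 : √(Fintype.card (TrainIdx d T W r) * Real.log (3 * ⌈2 * L⌉₊) / N)
        ≤ √(r * ((T + 1) * (d + W)) * Real.log (3 * ⌈2 * L⌉₊) / N) := by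
      refine Real.sqrt_le_sqrt (div_le_div_of_nonneg_right
        (mul_le_mul_of_nonneg_right card_trainIdx_le (Real.log_nonneg ?_)) (Nat.cast_nonneg _))
      have : (1 : ℝ) ≤ ⌈2 * L⌉₊ := by exact_mod_cast hm1
      linarith
    -- The cap 4 is harmless because every deviation is at most 2; otherwise `4 · 5/2 = 10`.
    rcases min_choice 1 (5 / 2 * √(r * ((T + 1) * (d + W)) * Real.log (3 * ⌈2 * L⌉₊) / N))
      with h4 | h4 <;> rw [h4]
    · linarith [Real.sqrt_nonneg (8 * Real.log (2 / ε) / N)]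
    · linarith
  have h1 : (1 : ℝ) ≤ μ.real (Good ∪ ({ω | ¬ ∀ e, |B e ω| ≤ β} ∪ Dev)) := by
    rw [← probReal_univ (μ := μ)]
    exact measureReal_mono hcover
  have h2 := measureReal_union_le (μ := μ) Good ({ω | ¬ ∀ e, |B e ω| ≤ β} ∪ Dev)
  have h3 := measureReal_union_le (μ := μ) {ω | ¬ ∀ e, |B e ω| ≤ β} Dev
  linarith

end LoRA

theorem theorem1 (σ : ℝ → ℝ) (hσ : LoRA.AdmissibleActivation σ)
    (d T W : ℕ) (hd : 1 ≤ d) (hT : 1 ≤ T) (κ : ℝ) (hκ : 1 < κ) :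
    ∃ c : ℝ, 0 < c ∧
      ∀ (D r : ℕ), 1 ≤ D → 1 ≤ r → r < W →
      -- pre-trained parameters, bound on the trainable entries, scale of the frozen factors
      ∀ (θ : LoRA.Params d D T W) (M : ℝ) (ν : ℝ≥0), 0 < M → 0 < ν →
      -- the loss
      ∀ (ℓ : LoRA.E D → LoRA.E D → ℝ), (∀ y y', ℓ y y' ∈ Set.Icc (0 : ℝ) 1) →
        LipschitzWith 1 (fun p : WithLp 2 (LoRA.E D × LoRA.E D) => ℓ p.fst p.snd) →
      -- the data distribution
      ∀ (P : Measure (LoRA.E d × LoRA.E D)) [IsProbabilityMeasure P],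
        (∀ᵐ z ∂P, ∀ i, z.1 i ∈ Set.Icc (0 : ℝ) 1) →
      ∀ (N : ℕ), 1 ≤ N →
      -- the random frozen factors `B` and the training data `Z`
      ∀ (Ω : Type*) [MeasurableSpace Ω] (μ : Measure Ω) [IsProbabilityMeasure μ]
        (B : LoRA.FrozenIdx D T W r → Ω → ℝ) (Z : Fin N → Ω → LoRA.E d × LoRA.E D),
        (∀ e, HasLaw (B e) (gaussianReal 0 (ν ^ 2)) μ) → iIndepFun B μ →
        (∀ n, HasLaw (Z n) P μ) → iIndepFun Z μ →
        IndepFun (fun ω e => B e ω) (fun ω n => Z n ω) μ →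
      ∀ (δ : ℝ), 0 < δ → δ ≤ 1 →
        κ ≤ 2 * LoRA.radius W r M ν (LoRA.epsOf δ) + 2 * θ.supNorm →
        1 - δ ≤ μ.real {ω |
          LoRA.genGap P ℓ (LoRA.loraClass σ θ M (fun e => B e ω)) (fun n => Z n ω)
            ≤ LoRA.gapBound d D T W r N c (LoRA.radius W r M ν (LoRA.epsOf δ)) θ.supNorm
                (LoRA.epsOf δ)} := by
  obtain ⟨C, hC, hσL, hσ0⟩ := hσ.exists_lipschitz
  set a : ℝ := C * ((d + W + 2 : ℝ) * (2 + W * (T * W + 1))) with ha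
  have hκl : 0 < Real.log κ := Real.log_pos hκ
  have hd' : (1 : ℝ) ≤ d := by exact_mod_cast hd
  have hT' : (1 : ℝ) ≤ T := by exact_mod_cast hT
  have hW0 : (0 : ℝ) ≤ W := W.cast_nonneg
  have ha1 : 1 ≤ a := by
    have : 0 ≤ (W : ℝ) * (T * W + 1) := by positivity
    exact one_le_mul_of_one_le_of_one_le hC
      (one_le_mul_of_one_le_of_one_le (by linarith) (by linarith))
  set c₀ : ℝ := (Real.log (9 * (T + 1) * a ^ (T + 1)) + (T + 2)) / Real.log κ + (T + 1) with hc₀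
  have hc₀pos : 0 < c₀ := by
    have : 0 ≤ Real.log (9 * (T + 1) * a ^ (T + 1)) :=
      Real.log_nonneg (one_le_mul_of_one_le_of_one_le (by linarith) (one_le_pow₀ ha1))
    positivity
  -- The first two factors bound `p / r`, and `c₀` bounds `log (3m) / (D log K)`.
  refine ⟨(T + 1) * (d + W) * c₀, by positivity, ?_⟩
  intro D r hD hr hrW θ M ν hM hν ℓ hℓ01 hℓ P _ hP N hN Ω _ μ _ B Z hB _ hZ hZi hBZ δ hδ hδ1 hK
  set ε := LoRA.epsOf δ with hε
  have hε0 : 0 < ε := LoRA.epsOf_pos hδ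
  have hε1 : ε ≤ 1 := LoRA.epsOf_le_one δ
  have hD' : (1 : ℝ) ≤ D := by exact_mod_cast hD
  have hN' : (0 : ℝ) < N := by exact_mod_cast hN
  have hθ0 := θ.supNorm_nonneg
  set R := LoRA.radius W r M ν ε with hR
  have hR0 : 0 ≤ R := by rw [hR, LoRA.radius]; positivity
  set K := 2 * R + 2 * θ.supNorm with hKdef
  have hK1 : 1 < K := hκ.trans_le hK
  have hKl : 0 < Real.log K := Real.log_pos hK1
  -- The 2 absorbs `1 + R₀`, as `1 < K` and `R₀ ≤ K`; the rest is the Gaussian perturbation, with `2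
  -- R ≤ K`.
  set H : ℝ := (2 + W * (T * W + 1)) * D * K with hH
  have hHle : 1 + θ.supNorm + r * (ν * √(2 * Real.log (4 * (r * (T * W + D)) / ε))) * M ≤ H := by
    have h1 := LoRA.perturbation_le_radius (T := T) hD hr hrW hM.le ν.coe_nonneg hε0 hε1
    rw [← hR] at h1
    have h2 : 2 * R ≤ K := by linarith
    have h3 : (0 : ℝ) ≤ W * (T * W + 1) * D := by positivity
    have h4 := mul_le_mul_of_nonneg_left h2 h3
    have h5 : K ≤ D * K := le_mul_of_one_le_left (by linarith) hD'
    calc _ ≤ 2 * (D * K) + W * (T * W + 1) * D * K := by linarith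
      _ = H := by rw [hH]; ring
  -- The two failure probabilities add up to `ε = 1 - √(1 - δ) ≤ δ`.
  refine (sub_le_sub_left (LoRA.epsOf_le_self hδ.le hδ1) 1).trans
    ((LoRA.one_sub_le_measureReal_genGap_le hd hT hD hr (by omega) hN hC hσL hσ0 θ hM hν hℓ01 hℓ P hP hB hZ
      hZi hBZ hε0 hε1 hHle rfl).trans (measureReal_mono
      (Set.ofPred_subset_ofPred.2 fun ω hω => hω.trans ?_)))
  rw [LoRA.gapBound, ← hKdef]
  refine add_le_add (mul_le_mul_of_nonneg_left (min_le_min le_rfl ?_) (by norm_num)) le_rfl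
  have hlog := LoRA.log_gridSize_le (T := T) hD ha1 hκ hK rfl
  rw [← hc₀] at hlog
  rw [show C * ((d + W + 2 : ℝ) * H) = a * D * K by rw [hH, ha]; ring]
  set Λ := Real.log (3 * ⌈2 * (D * (T + 1) * (a * D * K) ^ (T + 1))⌉₊)
  set c : ℝ := (T + 1) * (d + W) * c₀ with hc
  set A := (c * T + 1) * Real.log K with hA
  have hc0 : 0 ≤ c := by positivity
  have hA0 : 0 ≤ A := by positivity
  have hcA : c * Real.log K ≤ A := by
    refine mul_le_mul_of_nonneg_right ?_ hKl.le
    linarith [le_mul_of_one_le_right hc0 hT']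
  -- The only part of `q` that is needed: it pays for the factor `D` in `hlog`.
  have hq : r * (D : ℝ) ≤ LoRA.effDim d D T W r := by
    refine mul_le_mul_of_nonneg_left ?_ r.cast_nonneg
    linarith [mul_nonneg hW0 (sub_nonneg.2 hT')]
  have hq0 : 0 ≤ LoRA.effDim d D T W r := le_trans (by positivity) hq
  have hmain : r * ((T + 1) * (d + W)) * Λ ≤ LoRA.effDim d D T W r * A := by
    calc r * ((T + 1) * (d + W)) * Λ
        ≤ r * ((T + 1) * (d + W)) * (D * Real.log K * c₀) :=
          mul_le_mul_of_nonneg_left hlog (by positivity)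
      _ = r * D * (c * Real.log K) := by rw [hc]; ring
      _ ≤ _ := mul_le_mul hq hcA (by positivity) hq0
  calc 5 / 2 * √(r * ((T + 1) * (d + W)) * Λ / N)
      ≤ 6 * √(LoRA.effDim d D T W r * A / N) := by
        refine mul_le_mul (by norm_num) (Real.sqrt_le_sqrt ?_) (Real.sqrt_nonneg _) (by norm_num)
        exact div_le_div_of_nonneg_right hmain hN'.le
    _ = _ := by
        rw [Real.sqrt_div' _ hN'.le, Real.sqrt_mul hq0]
        ring
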